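/- \textbf{Definitions.} Let $k\ge 5$ be an integer, $\alpha=180^\circ/k$ (so $0<\alpha<45^\circ$), and let $S$ be a finite set of points in the plane. Let $\Delta_1$ be a triangle $ABC$ (clockwise) with angles $2\alpha,\,90^\circ-\alpha,\,90^\circ-\alpha$ at $A,B,C$ whose angle bisector at $A$ points vertically upward, and let $\Delta_i$ be $\Delta_1$ rotated clockwise around $A$ by $2(i-1)\alpha$, $1\le i\le k$. For a fixed $i$ and a point $q$, the $a$-wedge $W_{q,a}$ is the closed wedge with apex $q$ obtained by translating the wedge of $\Delta_i$ at $A$; the \emph{$a$-nearest neighbor} of $q\in S$ is the first point of $S\setminus\{q\}$ that is hit when $W_{q,a}$ is swept by a line parallel to $BC$ starting at $q$, ties being broken by choosing the most clockwise point as seen from $q$. Wedges $W_{q,b},W_{q,c}$ and $b$-, $c$-nearest neighbors are defined in the same way at $B$ and $C$. $G_i$ is the graph that joins every point of $S$ to its $a$-, $b$- and $c$-nearest neighbors with respect to $\Delta_i$, and $H_k=G_1\cup\dots\cup G_k$ is the \emph{$k$-layer 3-sweep graph} of $S$. \textbf{Algorithm $\mathcal A$.} For a source $q$ and a target $t$,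 choose an index $i$ (depending only on $q$ and $t$) with $t\in W_{q,a}$ with respect to $\Delta_i$. This index travels with the message unchanged, and all wedges, neighbors and edges below refer to $\Delta_i$ and $G_i$. Start at $u=q$ and stop as soon as $u=t$. While $t$ is an interior point of $W_{u,a}$, move from $u$ to its $a$-nearest neighbor. Otherwise, if $u\in W_{t,b}$ (left routing): if $u$ has neighbors $v$ in $G_i$ with $v\in W_{t,b}$ and $u\in W_{v,b}$, move to the first of them in clockwise order around $u$; if there is none, move to the $a$-nearest neighbor of $u$. Otherwise (right routing) do the same with $c$ in place of $b$ and counterclockwise in place of clockwise. A routing algorithm is \emph{$r$-local} if each next vertex is determined by the current vertex $u$, the target $t$, the index $i$ carried by the message, and the $r$-neighborhood of $u$ in $H_k$ (for $r=1$: the neighbors of $u$; for $r=2$: also their neighbors), but not by any other information on $S$ or on the vertices visited before. A path is \emph{angle-monotone of width $\gamma$} if the vectors of all its edges lie in one wedge of angle $\gamma$. The \emph{routing ratio} is the maximum, over all $S$ and all $q,t\in S$, $q\neq t$, of the length of the path found from $q$ to $t$ divided by $|qt|$. \textbf{Theorem.} (1) For every integer $k\ge5$, Algorithm $\mathcal A$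 can be carried out by a 2-local routing algorithm on the $k$-layer 3-sweep graphs $H_k$ of all finite point sets $S$. For all $q,t\in S$ (and every admissible choice of $i$) it reaches $t$ after finitely many steps along edges of $H_k$, on an angle-monotone path of width $90^\circ+\alpha$; its routing ratio is at most $1/\cos(45^\circ+\frac{\alpha}{2})$. (2) For $k=6$, i.e. $\alpha=30^\circ$, $H_6$ is the full-$\Theta_6$-graph of $S$ (each point $q$ is joined, in each of the six closed $60^\circ$ cones at $q$ whose bisectors make angles $90^\circ+60^\circ j$ with the positive horizontal axis, to the point whose projection onto the bisector is nearest to $q$, ties being broken by choosing the most clockwise point). The width in (1) is then $120^\circ$ and the routing ratio is at most $2$. Moreover, on the graphs $H_6$ of all finite point sets $S$ in which no ties occur (i.e. for each point of $S$ and each of its wedges, the sweep line first hits at most one point), Algorithm $\mathcal A$ can be carried out by a 1-local routing algorithm, with the same width $120^\circ$ and routing ratio at most $2$. -/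

import Mathlib

namespace SweepRouting

noncomputable section

/-- The Euclidean plane. -/
abbrev Plane := EuclideanSpace ℝ (Fin 2)

/-- The unit vector whose counterclockwise angle from the positive horizontal axis is `φ`. -/
def unit (φ : ℝ) : Plane := !₂[Real.cos φ, Real.sin φ]

/-- The planar cross product; it is positive iff `v` is counterclockwise of `u`
(by an angle strictly between `0` and `π`) and negative iff `v` is clockwise of `u`. -/
def cross (u v : Plane) : ℝ := u 0 * v 1 - u 1 * v 0

/-! ### 3-sweep graphs

In everything below `X, Y, Z` is the list of corners of a triangle in clockwise order, starting
from the corner under consideration: `(A, B, C)`, `(B, C, A)` or `(C, A, B)`. -/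

/-- The (closed) wedge with apex `q` whose sides are parallel to `XY` and `XZ`, i.e. the wedge
of the triangle at `X` translated so that `X` coincides with `q`. -/
def wedge (X Y Z q : Plane) : Set Plane :=
  {p | ∃ s r : ℝ, 0 ≤ s ∧ 0 ≤ r ∧ p = q + s • (Y - X) + r • (Z - X)}

/-- The time at which `p` is hit by a line parallel to `YZ` that starts at `q` and sweeps the
wedge of `q` at the corner `X`. As `X, Y, Z` is clockwise, it is non-negative on this wedge. -/
def sweepTime (Y Z q p : Plane) : ℝ := cross (Z - Y) (p - q)

/-- `p` is among the first points of `S` (other than `q`) that are hit when the wedge of `q` at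
the corner `X` is swept by a line parallel to `YZ`. -/
def IsFirstHit (X Y Z : Plane) (S : Finset Plane) (q p : Plane) : Prop :=
  p ∈ S ∧ p ≠ q ∧ p ∈ wedge X Y Z q ∧
    ∀ p' ∈ S, p' ≠ q → p' ∈ wedge X Y Z q → sweepTime Y Z q p ≤ sweepTime Y Z q p'

/-- `p` is the nearest neighbour of `q` in its wedge at the corner `X`: it is a first point hit
by the sweep and, in the case of ties, the most clockwise one as seen from `q`. -/
def IsNearest (X Y Z : Plane) (S : Finset Plane) (q p : Plane) : Prop :=
  IsFirstHit X Y Z S q p ∧ ∀ p', IsFirstHit X Y Z S q p' → cross (p' - q) (p - q) ≤ 0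

/-- `p` is the `a`-, `b`- or `c`-nearest neighbour of the point `q` of `S`. -/
def SweepsTo (A B C : Plane) (S : Finset Plane) (q p : Plane) : Prop :=
  q ∈ S ∧ (IsNearest A B C S q p ∨ IsNearest B C A S q p ∨ IsNearest C A B S q p)

/-- The 3-sweep graph of `S` for the triangle `ABC` (points outside `S` are isolated). -/
def threeSweep (A B C : Plane) (S : Finset Plane) : SimpleGraph Plane where
  Adj p q := p ≠ q ∧ (SweepsTo A B C S p q ∨ SweepsTo A B C S q p)
  symm := ⟨fun _ _ h => ⟨h.1.symm, h.2.symm⟩⟩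
  loopless := ⟨fun _ h => h.1 rfl⟩

/-! ### Layered 3-sweep graphs

With `α = π / k`, the `i`-th triangle (`i = 0, …, k - 1`) is isosceles with angle `2α` at the
corner `A`, placed at the origin, and angles `π/2 - α` at `B` and `C`. For `i = 0` the bisector
at `A` points vertically upward; the `i`-th triangle is rotated clockwise by `2πi/k`. -/

/-- The corner `A` of every layer. -/
def cornerA : Plane := 0

/-- The corner `B` of the `i`-th layer. -/
def cornerB (k : ℕ) (i : Fin k) : Plane :=
  unit (Real.pi / 2 + Real.pi / k - 2 * Real.pi * (i : ℕ) / k)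

/-- The corner `C` of the `i`-th layer. -/
def cornerC (k : ℕ) (i : Fin k) : Plane :=
  unit (Real.pi / 2 - Real.pi / k - 2 * Real.pi * (i : ℕ) / k)

/-- The `a`-wedge of `q` in the `i`-th layer. -/
def wedgeA (k : ℕ) (i : Fin k) (q : Plane) : Set Plane :=
  wedge cornerA (cornerB k i) (cornerC k i) q

/-- The `b`-wedge of `q` in the `i`-th layer. -/
def wedgeB (k : ℕ) (i : Fin k) (q : Plane) : Set Plane :=
  wedge (cornerB k i) (cornerC k i) cornerA q

/-- The `c`-wedge of `q` in the `i`-th layer. -/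
def wedgeC (k : ℕ) (i : Fin k) (q : Plane) : Set Plane :=
  wedge (cornerC k i) cornerA (cornerB k i) q

/-- The `i`-th layer, a 3-sweep graph with angles `2α, π/2 - α, π/2 - α`. -/
def layer (k : ℕ) (i : Fin k) (S : Finset Plane) : SimpleGraph Plane :=
  threeSweep cornerA (cornerB k i) (cornerC k i) S

/-- The `k`-layer 3-sweep graph `H_k` of `S`, the union of its `k` layers. -/
def layeredSweep (k : ℕ) (S : Finset Plane) : SimpleGraph Plane := ⨆ i : Fin k, layer k i S

/-- No nearest neighbour of a point of `S` has to be selected by breaking a tie: in each wedge of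
each layer the sweep line hits at most one point of `S` first. -/
def NoTies (k : ℕ) (S : Finset Plane) : Prop :=
  ∀ i : Fin k, ∀ q ∈ S, ∀ p p' : Plane,
    (IsFirstHit cornerA (cornerB k i) (cornerC k i) S q p →
      IsFirstHit cornerA (cornerB k i) (cornerC k i) S q p' → p = p') ∧
    (IsFirstHit (cornerB k i) (cornerC k i) cornerA S q p →
      IsFirstHit (cornerB k i) (cornerC k i) cornerA S q p' → p = p') ∧
    (IsFirstHit (cornerC k i) cornerA (cornerB k i) S q p →
      IsFirstHit (cornerC k i) cornerA (cornerB k i) S q p' → p = p')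

/-! ### Full theta-graphs -/

/-- The set of vectors at angle at most `γ / 2` from the direction `φ` (with the zero vector):
the closed wedge of angle `γ` with apex the origin and bisector in direction `φ`. -/
def cone (φ γ : ℝ) : Set Plane :=
  {v | ‖v‖ * Real.cos (γ / 2) ≤ inner ℝ (unit φ) v}

/-- The direction of the bisector of the `j`-th of `m` cones of angle `2π/m`. -/
def thetaAxis (m : ℕ) (j : Fin m) : ℝ := Real.pi / 2 + 2 * Real.pi * (j : ℕ) / m

/-- `p` is a point of `S` in the `j`-th cone of `q` whose projection to the bisector is nearest
to `q`. -/
def IsThetaClosest (m : ℕ) (j : Fin m) (S : Finset Plane) (q p : Plane) : Prop :=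
  p ∈ S ∧ p ≠ q ∧ p - q ∈ cone (thetaAxis m j) (2 * Real.pi / m) ∧
    ∀ p' ∈ S, p' ≠ q → p' - q ∈ cone (thetaAxis m j) (2 * Real.pi / m) →
      inner ℝ (unit (thetaAxis m j)) (p - q) ≤ inner ℝ (unit (thetaAxis m j)) (p' - q)

/-- `p` is the neighbour that `q` selects in its `j`-th cone; ties are broken by taking the most
clockwise point. -/
def IsThetaNearest (m : ℕ) (j : Fin m) (S : Finset Plane) (q p : Plane) : Prop :=
  IsThetaClosest m j S q p ∧ ∀ p', IsThetaClosest m j S q p' → cross (p' - q) (p - q) ≤ 0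

/-- The full `Θ_m`-graph of `S`. -/
def fullTheta (m : ℕ) (S : Finset Plane) : SimpleGraph Plane where
  Adj p q := p ≠ q ∧ ∃ j : Fin m,
    (p ∈ S ∧ IsThetaNearest m j S p q) ∨ (q ∈ S ∧ IsThetaNearest m j S q p)
  symm := ⟨fun _ _ ⟨hne, j, h⟩ => ⟨hne.symm, j, h.symm⟩⟩
  loopless := ⟨fun _ h => h.1 rfl⟩

/-! ### Algorithm A, in the `i`-th layer and with target `t` -/

/-- `v` is a candidate for Case 1 of left routing at `u`: a neighbour of `u` in the layer such
that `v` is in the `b`-wedge of `t` and `u` is in the `b`-wedge of `v`. -/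
def LeftCandidate (k : ℕ) (i : Fin k) (S : Finset Plane) (t u v : Plane) : Prop :=
  (layer k i S).Adj u v ∧ v ∈ wedgeB k i t ∧ u ∈ wedgeB k i v

/-- One step `u → w` of left routing. Case 1: `w` is the first candidate in clockwise order
around `u`. Case 2: there is no candidate, and `w` is the `a`-neighbour of `u`.
All candidates lie in a wedge of `u` of angle less than `π/2`, where clockwise order around `u`
is given by the sign of the cross product. -/
def LeftStep (k : ℕ) (i : Fin k) (S : Finset Plane) (t u w : Plane) : Prop :=
  (LeftCandidate k i S t u w ∧
    ∀ v, LeftCandidate k i S t u v → v ≠ w → cross (w - u) (v - u) < 0) ∨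
  ((¬ ∃ v, LeftCandidate k i S t u v) ∧
    IsNearest cornerA (cornerB k i) (cornerC k i) S u w)

/-- The mirror image of `LeftCandidate`, with `c`-wedges. -/
def RightCandidate (k : ℕ) (i : Fin k) (S : Finset Plane) (t u v : Plane) : Prop :=
  (layer k i S).Adj u v ∧ v ∈ wedgeC k i t ∧ u ∈ wedgeC k i v

/-- The mirror image of `LeftStep`: in Case 1, `w` is the first candidate in counterclockwise
order around `u`. -/
def RightStep (k : ℕ) (i : Fin k) (S : Finset Plane) (t u w : Plane) : Prop :=
  (RightCandidate k i S t u w ∧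
    ∀ v, RightCandidate k i S t u v → v ≠ w → 0 < cross (w - u) (v - u)) ∨
  ((¬ ∃ v, RightCandidate k i S t u v) ∧
    IsNearest cornerA (cornerB k i) (cornerC k i) S u w)

/-- Algorithm A forwards the message from `u` to `w`. While `t` is an internal point of the
`a`-wedge of `u`, it moves to the `a`-neighbour of `u`. Otherwise it routes left if `u` is in the
`b`-wedge of `t`, and right if not. -/
def StepA (k : ℕ) (i : Fin k) (S : Finset Plane) (t u w : Plane) : Prop :=
  (t ∈ interior (wedgeA k i u) ∧ IsNearest cornerA (cornerB k i) (cornerC k i) S u w) ∨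
  (t ∉ interior (wedgeA k i u) ∧ u ∈ wedgeB k i t ∧ LeftStep k i S t u w) ∨
  (t ∉ interior (wedgeA k i u) ∧ u ∉ wedgeB k i t ∧ RightStep k i S t u w)

/-! ### Local routing -/

/-- The `r`-neighbourhood of `u` in `G`: the edges of `G` with an endpoint at distance less than
`r` from `u`. For `r = 1` these are the edges from `u` to its neighbours, for `r = 2` also the
edges from the neighbours of `u` to their neighbours. -/
def localView (G : SimpleGraph Plane) (r : ℕ) (u : Plane) : SimpleGraph Plane where
  Adj v w := G.Adj v w ∧ ((∃ p : G.Walk u v, p.length < r) ∨ ∃ p : G.Walk u w, p.length < r)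
  symm := ⟨fun _ _ h => ⟨h.1.symm, h.2.symm⟩⟩
  loopless := ⟨fun _ h => h.1.ne rfl⟩

/-- A routing algorithm for `k`-layer graphs. `start q t` is the index of the layer used for
a message from `q` to `t`; it accompanies the message and is never changed. `next i t u V` is
the vertex to which a message for `t` with layer index `i` is forwarded from the current vertex
`u`, if the visible part of the graph is `V`. -/
structure Router (k : ℕ) where
  start : Plane → Plane → Fin k
  next : Fin k → Plane → Plane → SimpleGraph Plane → Plane

/-- The vertices visited by a message from `q` to `t` with layer index `i` in the graph `G`, if
at each vertex only its `r`-neighbourhood is visible. -/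
def Router.route {k : ℕ} (R : Router k) (r : ℕ) (G : SimpleGraph Plane) (i : Fin k)
    (q t : Plane) : ℕ → Plane
  | 0 => q
  | n + 1 => R.next i t (R.route r G i q t n) (localView G r (R.route r G i q t n))

/-- The path `x 0, …, x m` is angle-monotone of width `γ`: the vectors of all its edges lie in
one wedge of angle `γ`. -/
def AngleMonotone (γ : ℝ) (x : ℕ → Plane) (m : ℕ) : Prop :=
  ∃ φ : ℝ, ∀ j < m, x (j + 1) - x j ∈ cone φ γ

/-- The length of the path `x 0, …, x m`. -/
def pathLength (x : ℕ → Plane) (m : ℕ) : ℝ := ∑ j ∈ Finset.range m, dist (x j) (x (j + 1))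

/-- On every finite point set `S` with property `P`, the router `R`, seeing only
`r`-neighbourhoods in `H_k`, executes algorithm A and reaches the target along an angle-monotone
path of width `γ`, with routing ratio at most `ρ`. The layer index is one for which the target
is in the `a`-wedge of the source; if there are several, each of them works. -/
def Router.Works {k : ℕ} (R : Router k) (r : ℕ) (P : Finset Plane → Prop) (γ ρ : ℝ) : Prop :=
  (∀ q t, t ∈ wedgeA k (R.start q t) q) ∧
  ∀ S : Finset Plane, P S → ∀ q ∈ S, ∀ t ∈ S, ∀ i : Fin k, t ∈ wedgeA k i q →
    ∃ m : ℕ,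
      R.route r (layeredSweep k S) i q t m = t ∧
      (∀ j < m,
        R.route r (layeredSweep k S) i q t j ≠ t ∧
        (layeredSweep k S).Adj (R.route r (layeredSweep k S) i q t j)
          (R.route r (layeredSweep k S) i q t (j + 1)) ∧
        StepA k i S t (R.route r (layeredSweep k S) i q t j)
          (R.route r (layeredSweep k S) i q t (j + 1))) ∧
      AngleMonotone γ (R.route r (layeredSweep k S) i q t) m ∧
      pathLength (R.route r (layeredSweep k S) i q t) m ≤ ρ * dist q t

end

end SweepRouting

open SweepRouting

namespace SweepRouting

/-! Within one layer only linear orders matter. In the basis `AB`, `AC` a point has coordinates `s`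
and `r`; the a-, b- and c-sweeps compare the height `s + r`, then `s`, then `r`, and "most
clockwise" among tied points compares a single coordinate. Routing thus becomes combinatorics of two
real functions on a finite set; angles enter only at the end.

The heart is the invariant `LeftState` (with mirror image `RightState`): `u` is in the b-wedge of
`t`, and no point of `S` has `r ≥ r t`, `s > s u` and smaller height than `u`. If a step broke the
emptiness, an extremal offending point would have `u` as its b-nearest neighbour, and so would be an
earlier candidate (Case 1) or a candidate where there is none (Case 2). The same argument applied to
`t` shows that in Case 2 the a-neighbour exists and is not higher than `t`. Clockwise tie-breaking
spoils the mirror symmetry: `LeftState` also records that `u` wins its ties in b-sweeps, while on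
the right the corresponding fact can be derived.

Along left routing `s` and the height never decrease and their sum increases. This gives termination
and puts all edges in the wedge spanned by `C` and `B - C`, of angle `π/2 + α`; projecting on its
bisector bounds the length.

For locality, the nearest neighbours of a vertex can be read off from its neighbours in the union
graph. A candidate may be joined to `u` by its own sweep, so the 2-neighbourhood decides adjacency
in the layer. For `k = 6` the triangles are equilateral, so every edge of `H_6` comes from a wedge
of the current layer or from the reflection of one; without ties, this and the empty region identify
the candidates from the neighbours of `u` alone (`LeftState.candB_iff`, `RightState.candC_iff`). -/

section Abstract

variable {V : Type*} (s r : V → ℝ) (S : Finset V)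

/-! ### Sweeps in affine coordinates

A point `p` has coordinates `s p` and `r p` with respect to the sides `AB` and `AC` of the
triangle, and height `s p + r p`. -/

/-- `p` is in the `a`-wedge of `q`. -/
def InA (q p : V) : Prop := s q ≤ s p ∧ r q ≤ r p

/-- `p` is in the `b`-wedge of `q`. -/
def InB (q p : V) : Prop := r q ≤ r p ∧ s p + r p ≤ s q + r q

/-- `p` is in the `c`-wedge of `q`. -/
def InC (q p : V) : Prop := s q ≤ s p ∧ s p + r p ≤ s q + r q

/-- `p` is a first point hit in the `a`-wedge of `q`. -/
def FirstA (q p : V) : Prop :=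
  p ∈ S ∧ p ≠ q ∧ InA s r q p ∧ ∀ x ∈ S, x ≠ q → InA s r q x → s p + r p ≤ s x + r x

/-- `p` is a first point hit in the `b`-wedge of `q`. -/
def FirstB (q p : V) : Prop :=
  p ∈ S ∧ p ≠ q ∧ InB s r q p ∧ ∀ x ∈ S, x ≠ q → InB s r q x → s x ≤ s p

/-- `p` is a first point hit in the `c`-wedge of `q`. -/
def FirstC (q p : V) : Prop :=
  p ∈ S ∧ p ≠ q ∧ InC s r q p ∧ ∀ x ∈ S, x ≠ q → InC s r q x → r x ≤ r p

/-- `p` is the `a`-nearest neighbour of `q`. -/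
def NearA (q p : V) : Prop := FirstA s r S q p ∧ ∀ x, FirstA s r S q x → s p ≤ s x

/-- `p` is the `b`-nearest neighbour of `q`. -/
def NearB (q p : V) : Prop := FirstB s r S q p ∧ ∀ x, FirstB s r S q x → r p ≤ r x

/-- `p` is the `c`-nearest neighbour of `q`. -/
def NearC (q p : V) : Prop := FirstC s r S q p ∧ ∀ x, FirstC s r S q x → s x ≤ s p

/-- Adjacency in the 3-sweep graph. -/
def SweepAdj (u v : V) : Prop :=
  u ≠ v ∧ ((u ∈ S ∧ (NearA s r S u v ∨ NearB s r S u v ∨ NearC s r S u v)) ∨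
    (v ∈ S ∧ (NearA s r S v u ∨ NearB s r S v u ∨ NearC s r S v u)))

/-- Candidates for left routing. -/
def CandB (t u v : V) : Prop := SweepAdj s r S u v ∧ InB s r t v ∧ InB s r v u

/-- Candidates for right routing. -/
def CandC (t u v : V) : Prop := SweepAdj s r S u v ∧ InC s r t v ∧ InC s r v u

/-- The cross product of `v - u` and `w - u`, up to a positive factor. -/
def turn (u w v : V) : ℝ := (s w - s u) * (r v - r u) - (r w - r u) * (s v - s u)

/-- A step of left routing. -/
def StepB (t u w : V) : Prop :=
  (CandB s r S t u w ∧ ∀ v, CandB s r S t u v → v ≠ w → 0 < turn s r u w v) ∨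
  ((¬ ∃ v, CandB s r S t u v) ∧ NearA s r S u w)

/-- A step of right routing. -/
def StepC (t u w : V) : Prop :=
  (CandC s r S t u w ∧ ∀ v, CandC s r S t u v → v ≠ w → turn s r u w v < 0) ∨
  ((¬ ∃ v, CandC s r S t u v) ∧ NearA s r S u w)

/-- The invariant of left routing. -/
def LeftState (t u : V) : Prop :=
  u ∈ S ∧ t ∈ S ∧ InB s r t u ∧
  (∀ p ∈ S, r t ≤ r p → s u < s p → s u + r u ≤ s p + r p) ∧
  (∀ p ∈ S, InB s r t p → FirstB s r S p u → NearB s r S p u)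

/-- The invariant of right routing. -/
def RightState (t u : V) : Prop :=
  u ∈ S ∧ t ∈ S ∧ InC s r t u ∧
  (∀ p ∈ S, s t ≤ s p → r u < r p → s u + r u ≤ s p + r p)

/-- The target is an interior point of the `a`-wedge of the current vertex. -/
def InnerState (t u : V) : Prop := u ∈ S ∧ t ∈ S ∧ s u < s t ∧ r u < r t

variable {s r S}

/-! ### Existence of nearest neighbours and of first candidates -/

theorem exists_nearA {q x : V} (hx : x ∈ S) (hne : x ≠ q) (h : InA s r q x) :
    ∃ p, NearA s r S q p := by
  classical
  obtain ⟨p, hp, hmin⟩ := (S.filter fun x => x ≠ q ∧ InA s r q x).exists_min_image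
    (fun x => s x + r x) ⟨x, by simp [*]⟩
  simp only [Finset.mem_filter, and_imp] at hp hmin
  have hF : FirstA s r S q p := ⟨hp.1, hp.2.1, hp.2.2, hmin⟩
  obtain ⟨w, hw, hwmin⟩ := (S.filter fun x => FirstA s r S q x).exists_min_image
    s ⟨p, by simp [hp.1, hF]⟩
  simp only [Finset.mem_filter, and_imp] at hw hwmin
  exact ⟨w, hw.2, fun y hy => hwmin y hy.1 hy⟩

theorem exists_nearB {q x : V} (hx : x ∈ S) (hne : x ≠ q) (h : InB s r q x) :
    ∃ p, NearB s r S q p := by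
  classical
  obtain ⟨p, hp, hmin⟩ := (S.filter fun x => x ≠ q ∧ InB s r q x).exists_max_image
    s ⟨x, by simp [*]⟩
  simp only [Finset.mem_filter, and_imp] at hp hmin
  have hF : FirstB s r S q p := ⟨hp.1, hp.2.1, hp.2.2, hmin⟩
  obtain ⟨w, hw, hwmin⟩ := (S.filter fun x => FirstB s r S q x).exists_min_image
    r ⟨p, by simp [hp.1, hF]⟩
  simp only [Finset.mem_filter, and_imp] at hw hwmin
  exact ⟨w, hw.2, fun y hy => hwmin y hy.1 hy⟩

theorem exists_nearC {q x : V} (hx : x ∈ S) (hne : x ≠ q) (h : InC s r q x) :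
    ∃ p, NearC s r S q p := by
  classical
  obtain ⟨p, hp, hmin⟩ := (S.filter fun x => x ≠ q ∧ InC s r q x).exists_max_image
    r ⟨x, by simp [*]⟩
  simp only [Finset.mem_filter, and_imp] at hp hmin
  have hF : FirstC s r S q p := ⟨hp.1, hp.2.1, hp.2.2, hmin⟩
  obtain ⟨w, hw, hwmin⟩ := (S.filter fun x => FirstC s r S q x).exists_max_image
    s ⟨p, by simp [hp.1, hF]⟩
  simp only [Finset.mem_filter, and_imp] at hw hwmin
  exact ⟨w, hw.2, fun y hy => hwmin y hy.1 hy⟩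

/-- The ways in which a candidate for left routing can be adjacent to the current vertex. -/
theorem CandB.cases (hinj : ∀ p q : V, s p = s q → r p = r q → p = q) {t u v : V}
    (h : CandB s r S t u v) :
    (u ∈ S ∧ v ∈ S) ∧ u ≠ v ∧ s u < s v ∧
      ((NearA s r S u v ∧ r u = r v) ∨ (NearC s r S u v ∧ s u + r u = s v + r v) ∨
        NearB s r S v u) := by
  obtain ⟨⟨hne, h⟩, -, hb⟩ := h
  have key : ¬ s v ≤ s u := fun h' => hne <| hinj _ _
    (by have := hb.1; have := hb.2; linarith) (by have := hb.1; have := hb.2; linarith)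
  simp only [InB] at hb
  refine ⟨?_, hne, not_le.1 key, ?_⟩
  · rcases h with ⟨hu, h | h | h⟩ | ⟨hu, h | h | h⟩ <;> exact ⟨by first | exact hu | exact h.1.1,
      by first | exact hu | exact h.1.1⟩
  -- An a-edge from `u` survives only along `r u = r v`, a c-edge from `u` only at equal heights,
  -- and a b-edge from `v` always; the other three would give `s v ≤ s u`.
  · rcases h with ⟨hu, h | h | h⟩ | ⟨hu, h | h | h⟩
    · have := h.1.2.2.1.2
      exact Or.inl ⟨h, by linarith⟩
    · have h1 := h.1.2.2.1.1
      have h2 := h.1.2.2.1.2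
      exact absurd (by linarith) key
    · have := h.1.2.2.1.2
      exact Or.inr (Or.inl ⟨h, by linarith⟩)
    · exact absurd h.1.2.2.1.1 key
    · exact Or.inr (Or.inr h)
    · exact absurd h.1.2.2.1.1 key

/-- The ways in which a candidate for right routing can be adjacent to the current vertex. -/
theorem CandC.cases (hinj : ∀ p q : V, s p = s q → r p = r q → p = q) {t u v : V}
    (h : CandC s r S t u v) :
    (u ∈ S ∧ v ∈ S) ∧ u ≠ v ∧ r u < r v ∧
      ((NearA s r S u v ∧ s u = s v) ∨ (NearB s r S u v ∧ s u + r u = s v + r v) ∨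
        NearC s r S v u) := by
  obtain ⟨⟨hne, h⟩, -, hb⟩ := h
  have key : ¬ r v ≤ r u := fun h' => hne <| hinj _ _
    (by have := hb.1; have := hb.2; linarith) (by have := hb.1; have := hb.2; linarith)
  simp only [InC] at hb
  refine ⟨?_, hne, not_le.1 key, ?_⟩
  · rcases h with ⟨hu, h | h | h⟩ | ⟨hu, h | h | h⟩ <;> exact ⟨by first | exact hu | exact h.1.1,
      by first | exact hu | exact h.1.1⟩
  · rcases h with ⟨hu, h | h | h⟩ | ⟨hu, h | h | h⟩
    · have := h.1.2.2.1.1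
      exact Or.inl ⟨h, by linarith⟩
    · have := h.1.2.2.1.2
      exact Or.inr (Or.inl ⟨h, by linarith⟩)
    · have h1 := h.1.2.2.1.1
      have h2 := h.1.2.2.1.2
      exact absurd (by linarith) key
    · exact absurd h.1.2.2.1.2 key
    · exact absurd h.1.2.2.1.1 key
    · exact Or.inr (Or.inr h)

/-- Of two candidates on one ray from `u`, the nearer lies in the wedge whose sweep produced the
edge to the farther, and it would be hit too early. Hence the clockwise order on candidates is
strict. -/
theorem CandB.eq_of_turn_eq_zero (hinj : ∀ p q : V, s p = s q → r p = r q → p = q) {t u v w : V}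
    (hv : CandB s r S t u v) (hw : CandB s r S t u w) (h0 : turn s r u w v = 0) : v = w := by
  wlog hle : s v ≤ s w generalizing v w
  · exact (this hw hv (by unfold turn at *; linarith) (le_of_not_ge hle)).symm
  obtain ⟨hvS, hvne, hvs, -⟩ := hv.cases hinj
  obtain ⟨hwS, hwne, hws, hcase⟩ := hw.cases hinj
  obtain ⟨-, -, hv1, hv2⟩ := hv
  obtain ⟨-, -, hw1, hw2⟩ := hw
  unfold turn at h0
  have e1 : r w ≤ r v := by
    by_contra! h
    nlinarith [mul_nonneg (sub_nonneg.2 hle) (sub_nonneg.2 hw1),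
      mul_pos (sub_pos.2 hws) (sub_pos.2 h)]
  have e2 : s v + r v ≤ s w + r w := by
    by_contra! h
    nlinarith [mul_nonneg (sub_nonneg.2 hle) (sub_nonneg.2 hw2),
      mul_pos (sub_pos.2 hws) (sub_pos.2 h)]
  by_contra hne
  have hlt : s v < s w := lt_of_le_of_ne hle fun h => hne (hinj _ _ h (by linarith))
  rcases hcase with ⟨hn, he⟩ | ⟨hn, he⟩ | hn
  · have := hn.1.2.2.2 v hvS.2 hvne.symm ⟨hvs.le, by linarith⟩
    linarith
  · have : s v + r v = s u + r u := by linarith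
    have := hn.1.2.2.2 v hvS.2 hvne.symm ⟨hvs.le, by linarith⟩
    linarith
  · have := hn.1.2.2.2 v hvS.2 hne ⟨e1, e2⟩
    linarith

theorem CandC.eq_of_turn_eq_zero (hinj : ∀ p q : V, s p = s q → r p = r q → p = q) {t u v w : V}
    (hv : CandC s r S t u v) (hw : CandC s r S t u w) (h0 : turn s r u w v = 0) : v = w := by
  wlog hle : r v ≤ r w generalizing v w
  · exact (this hw hv (by unfold turn at *; linarith) (le_of_not_ge hle)).symm
  obtain ⟨hvS, hvne, hvs, -⟩ := hv.cases hinj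
  obtain ⟨hwS, hwne, hws, hcase⟩ := hw.cases hinj
  obtain ⟨-, -, hv1, hv2⟩ := hv
  obtain ⟨-, -, hw1, hw2⟩ := hw
  unfold turn at h0
  have e1 : s w ≤ s v := by
    by_contra! h
    nlinarith [mul_nonneg (sub_nonneg.2 hle) (sub_nonneg.2 hw1),
      mul_pos (sub_pos.2 hws) (sub_pos.2 h)]
  have e2 : s v + r v ≤ s w + r w := by
    by_contra! h
    nlinarith [mul_nonneg (sub_nonneg.2 hle) (sub_nonneg.2 hw2),
      mul_pos (sub_pos.2 hws) (sub_pos.2 h)]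
  by_contra hne
  have hlt : r v < r w := lt_of_le_of_ne hle fun h => hne (hinj _ _ (by linarith) h)
  rcases hcase with ⟨hn, he⟩ | ⟨hn, he⟩ | hn
  · have := hn.1.2.2.2 v hvS.2 hvne.symm ⟨by linarith, hvs.le⟩
    linarith
  · have : s v + r v = s u + r u := by linarith
    have := hn.1.2.2.2 v hvS.2 hvne.symm ⟨hvs.le, by linarith⟩
    linarith
  · have := hn.1.2.2.2 v hvS.2 hne ⟨e1, e2⟩
    linarith

/-- All candidates have `s u < s v`, so clockwise order is the order of the slopes `(r v - r u) / (s
v - s u)`, and a minimal slope comes first. -/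
theorem exists_first_candB (hinj : ∀ p q : V, s p = s q → r p = r q → p = q) {t u : V}
    (h : ∃ v, CandB s r S t u v) :
    ∃ w, CandB s r S t u w ∧ ∀ v, CandB s r S t u v → v ≠ w → 0 < turn s r u w v := by
  classical
  obtain ⟨v₀, h₀⟩ := h
  obtain ⟨w, hw, hmin⟩ := (S.filter fun v => CandB s r S t u v).exists_min_image
    (fun v => (r v - r u) / (s v - s u)) ⟨v₀, by simp [h₀, (h₀.cases hinj).1.2]⟩
  simp only [Finset.mem_filter] at hw hmin
  refine ⟨w, hw.2, fun v hv hne => lt_of_le_of_ne ?_ fun h0 => hne <|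
    hv.eq_of_turn_eq_zero hinj hw.2 h0.symm⟩
  have h1 := hmin v ⟨(hv.cases hinj).1.2, hv⟩
  rw [div_le_div_iff₀ (sub_pos.2 (hw.2.cases hinj).2.2.1) (sub_pos.2 (hv.cases hinj).2.2.1)] at h1
  unfold turn
  linarith

theorem exists_first_candC (hinj : ∀ p q : V, s p = s q → r p = r q → p = q) {t u : V}
    (h : ∃ v, CandC s r S t u v) :
    ∃ w, CandC s r S t u w ∧ ∀ v, CandC s r S t u v → v ≠ w → turn s r u w v < 0 := by
  classical
  obtain ⟨v₀, h₀⟩ := h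
  obtain ⟨w, hw, hmin⟩ := (S.filter fun v => CandC s r S t u v).exists_min_image
    (fun v => (s v - s u) / (r v - r u)) ⟨v₀, by simp [h₀, (h₀.cases hinj).1.2]⟩
  simp only [Finset.mem_filter] at hw hmin
  refine ⟨w, hw.2, fun v hv hne => lt_of_le_of_ne ?_ fun h0 => hne <|
    hv.eq_of_turn_eq_zero hinj hw.2 h0⟩
  have h1 := hmin v ⟨(hv.cases hinj).1.2, hv⟩
  rw [div_le_div_iff₀ (sub_pos.2 (hw.2.cases hinj).2.2.1) (sub_pos.2 (hv.cases hinj).2.2.1)] at h1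
  unfold turn
  linarith

/-! ### Left routing -/

/-- Case 1 preserves the invariant: a point that spoils it either spoils it already at `u`, or leads
to a candidate before `v`. -/
theorem LeftState.of_first (hinj : ∀ p q : V, s p = s q → r p = r q → p = q) {t u v : V}
    (h : LeftState s r S t u) (hv : CandB s r S t u v)
    (hfirst : ∀ x, CandB s r S t u x → x ≠ v → 0 < turn s r u v x) : LeftState s r S t v := by
  classical
  obtain ⟨huS, htS, htu, h1, h2⟩ := h
  obtain ⟨⟨-, hvS⟩, hne, hs, hcase⟩ := hv.cases hinj
  obtain ⟨-, htv, hvu⟩ := hv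
  simp only [InB] at htu htv hvu
  have hT : ∀ p ∈ S, s u + r u ≤ s p + r p → r t ≤ r p → s p + r p < s v + r v → r p < r v →
      False := by
    intro p₀ hp₀ ha hb hc hd
    -- With `s` minimal, the only point of this region in the b-wedge of `p` is `p` itself.
    obtain ⟨p, hp, hmin⟩ := (S.filter fun p => s u + r u ≤ s p + r p ∧ r t ≤ r p ∧
      s p + r p < s v + r v ∧ r p < r v).exists_min_image s ⟨p₀, by simp [*]⟩
    simp only [Finset.mem_filter, and_imp] at hp hmin
    obtain ⟨hpS, hp1, hp2, hp3, hp4⟩ := hp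
    have hpu : u ≠ p := by rintro rfl; linarith
    have hF : FirstB s r S p u := by
      refine ⟨huS, hpu, ⟨by linarith, by linarith⟩, fun x hx hxp hpx => ?_⟩
      by_contra! hlt
      obtain ⟨hpx1, hpx2⟩ := hpx
      have hxu := h1 x hx (by linarith) hlt
      rcases lt_or_ge (r x) (r v) with hxv | hxv
      · have := hmin x hx hxu (by linarith) (by linarith) hxv
        exact hxp (hinj _ _ (by linarith) (by linarith))
      -- Now `x` would be hit too early by the sweep that produced the edge `uv`; for a c-edge, `u`
      -- and `v` have equal height and `p` has no room between them.
      · rcases hcase with ⟨hn, he⟩ | ⟨hn, he⟩ | hn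
        · have := hn.1.2.2.2 x hx (by rintro rfl; linarith) ⟨hlt.le, by linarith⟩
          linarith
        · linarith
        · have := hn.1.2.2.2 x hx (by rintro rfl; linarith) ⟨hxv, by linarith⟩
          linarith
    have hN := h2 p hpS ⟨hp2, by linarith⟩ hF
    have := hfirst p ⟨⟨hpu, Or.inr ⟨hpS, Or.inr (Or.inl hN)⟩⟩, ⟨hp2, by linarith⟩, hF.2.2.1⟩
      (by rintro rfl; linarith)
    unfold turn at this
    nlinarith [mul_nonneg (sub_nonneg.2 hvu.2) (sub_nonneg.2 hp4.le),
      mul_nonneg (sub_nonneg.2 hvu.1) (sub_nonneg.2 hp3.le),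
      mul_nonneg (sub_nonneg.2 hp4.le) (sub_nonneg.2 hs.le)]
  -- The invariant asks this only for `s v < s p`; the case of equality is what lets `v` win its
  -- ties in b-sweeps.
  have hlow : ∀ p ∈ S, r t ≤ r p → s v ≤ s p → s v + r v ≤ s p + r p := by
    intro p hp hp1 hp2
    by_contra! hlt
    rcases lt_or_ge (s p + r p) (s u + r u) with hpu | hpu
    · have := h1 p hp hp1 (by linarith)
      linarith
    · exact hT p hp hpu hp1 hlt (by linarith)
  refine ⟨hvS, htS, htv, fun p hp hp1 hp2 => hlow p hp hp1 hp2.le, fun p hp htp hF =>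
    ⟨hF, fun x hx => ?_⟩⟩
  have e1 := hF.2.2.2 x hx.1 hx.2.1 hx.2.2.1
  have e2 := hx.2.2.2 v hvS hF.2.1 hF.2.2.1
  have := hlow x hx.1 (htp.1.trans hx.2.2.1.1) e2
  linarith

/-- Otherwise, among the points eligible as `p`, one with least `s` would have `u` as its b-nearest
neighbour and be a candidate. With `p = t` this supplies the a-neighbour needed in Case 2. -/
theorem LeftState.exists_inA (hinj : ∀ p q : V, s p = s q → r p = r q → p = q) {t u p : V}
    (h : LeftState s r S t u) (hno : ¬ ∃ v, CandB s r S t u v) (hp : p ∈ S) (hpu : p ≠ u)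
    (htp : InB s r t p) (hpu' : InB s r p u) :
    ∃ x ∈ S, x ≠ u ∧ InA s r u x ∧ s x + r x ≤ s p + r p := by
  classical
  obtain ⟨huS, htS, htu, h1, h2⟩ := h
  obtain ⟨q, hq, hmin⟩ := (S.filter fun q => q ≠ u ∧ InB s r t q ∧ InB s r q u ∧
      s q + r q ≤ s p + r p).exists_min_image s ⟨p, by simp [*]⟩
  simp only [Finset.mem_filter, and_imp] at hq hmin
  obtain ⟨hqS, hqu, htq, hqu', hqp⟩ := hq
  by_contra! hcon
  have hF : FirstB s r S q u := by
    refine ⟨huS, hqu.symm, hqu', fun x hx hxq hqx => ?_⟩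
    by_contra! hlt
    have hxu := h1 x hx (htq.1.trans hqx.1) hlt
    have hxu' : x ≠ u := by rintro rfl; exact lt_irrefl _ hlt
    have hxp : s x + r x ≤ s p + r p := hqx.2.trans hqp
    rcases lt_or_ge (r u) (r x) with hr | hr
    · exact absurd (hcon x hx hxu' ⟨hlt.le, hr.le⟩) (not_lt.2 hxp)
    · have := hmin x hx hxu' ⟨htq.1.trans hqx.1, hqx.2.trans htq.2⟩ ⟨hr, hxu⟩ hxp
      have e1 := hqx.1
      have e2 := hqx.2
      exact hxq (hinj _ _ (by linarith) (by linarith))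
  exact hno ⟨q, ⟨hqu.symm, Or.inr ⟨hqS, Or.inr (Or.inl (h2 q hqS htq hF))⟩⟩, htq, hqu'⟩

/-- A point spoiling the invariant at `w` would be lower than `u` (excluded by the old invariant),
or in the a-wedge of `u` (excluded by the sweep), or have `u` in its b-wedge (excluded by
`exists_inA`). -/
theorem LeftState.of_nearA (hinj : ∀ p q : V, s p = s q → r p = r q → p = q) {t u w : V}
    (h : LeftState s r S t u) (hne : u ≠ t) (hno : ¬ ∃ v, CandB s r S t u v)
    (hw : NearA s r S u w) : LeftState s r S t w := by
  have key : ∀ {p : V}, p ∈ S → p ≠ u → InB s r t p → InB s r p u → s w + r w ≤ s p + r p := by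
    intro p hp hpu h3 h4
    obtain ⟨x, hx, hxu, hux, hxp⟩ := h.exists_inA hinj hno hp hpu h3 h4
    exact (hw.1.2.2.2 x hx hxu hux).trans hxp
  obtain ⟨huS, htS, htu, h1, h2⟩ := h
  obtain ⟨⟨hwS, hwu, ⟨hw1, hw2⟩, hwmin⟩, hwtie⟩ := hw
  have hwt := key htS hne.symm ⟨le_rfl, le_rfl⟩ htu
  simp only [InB] at htu
  -- The exception arises when the step keeps `s` constant; it does not affect the empty region but
  -- has to be treated among the ties.
  have hlow : ∀ p ∈ S, r t ≤ r p → s w ≤ s p → s p + r p < s w + r w → s w = s u ∧ s p = s u ∧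
      s p + r p ≤ s u + r u := by
    intro p hp hp1 hp2 hlt
    rcases lt_or_ge (s p + r p) (s u + r u) with hpu | hpu
    · have : ¬ s u < s p := fun h' => absurd (h1 p hp hp1 h') (not_le.2 hpu)
      exact ⟨by linarith, by linarith, hpu.le⟩
    · by_cases hpe : p = u
      · subst hpe
        exact ⟨by linarith, rfl, le_rfl⟩
      · rcases lt_or_ge (r p) (r u) with hr | hr
        · have := key hp hpe ⟨hp1, by linarith⟩ ⟨hr.le, hpu⟩
          linarith
        · have := hwmin p hp hpe ⟨by linarith, hr⟩
          linarith
  refine ⟨hwS, htS, ⟨by linarith, hwt⟩, fun p hp hp1 hp2 => ?_, fun p hp htp hF =>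
    ⟨hF, fun x hx => ?_⟩⟩
  · by_contra! hlt
    have := hlow p hp hp1 hp2.le hlt
    linarith
  · by_contra! hlt
    have e1 := hF.2.2.2 x hx.1 hx.2.1 hx.2.2.1
    have e2 := hx.2.2.2 w hwS hF.2.1 hF.2.2.1
    obtain ⟨e3, e4, e5⟩ := hlow x hx.1 (htp.1.trans hx.2.2.1.1) e2 (by linarith)
    have e6 := hx.2.2.1.1
    have e7 := hF.2.2.1.2
    have hup : u ≠ p := by
      rintro rfl
      have := hwmin w hwS hwu ⟨hw1, hw2⟩
      exact hwu (hinj _ _ e3 (by linarith))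
    have hpu : InB s r p u := ⟨by linarith, by linarith⟩
    -- As `s w = s u`, the vertex `u` ties with `w` in the b-sweep of `p`; the tie clause at `u`
    -- then makes `p` a candidate.
    have hFu : FirstB s r S p u :=
      ⟨huS, hup, hpu, fun y hy hyp hpy => (hF.2.2.2 y hy hyp hpy).trans e3.le⟩
    exact hno ⟨p, ⟨hup, Or.inr ⟨hp, Or.inr (Or.inl (h2 p hp htp hFu))⟩⟩, htp, hpu⟩

/-! ### Right routing -/

/-- The mirror image of `LeftState.of_first`, except that `u` has to be shown to win the tie in the
c-sweep of `p`, where largest `s` is preferred. -/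
theorem RightState.of_first (hinj : ∀ p q : V, s p = s q → r p = r q → p = q) {t u v : V}
    (h : RightState s r S t u) (hv : CandC s r S t u v)
    (hfirst : ∀ x, CandC s r S t u x → x ≠ v → turn s r u v x < 0) : RightState s r S t v := by
  classical
  obtain ⟨huS, htS, htu, h1⟩ := h
  obtain ⟨⟨-, hvS⟩, hne, hs, hcase⟩ := hv.cases hinj
  obtain ⟨-, htv, hvu⟩ := hv
  simp only [InC] at htu htv hvu
  have hT : ∀ p ∈ S, s u + r u ≤ s p + r p → s t ≤ s p → s p + r p < s v + r v → s p < s v →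
      False := by
    intro p₀ hp₀ ha hb hc hd
    obtain ⟨p, hp, hmin⟩ := (S.filter fun p => s u + r u ≤ s p + r p ∧ s t ≤ s p ∧
      s p + r p < s v + r v ∧ s p < s v).exists_min_image r ⟨p₀, by simp [*]⟩
    simp only [Finset.mem_filter, and_imp] at hp hmin
    obtain ⟨hpS, hp1, hp2, hp3, hp4⟩ := hp
    have hpu : u ≠ p := by rintro rfl; linarith
    have hF : FirstC s r S p u := by
      refine ⟨huS, hpu, ⟨by linarith, by linarith⟩, fun x hx hxp hpx => ?_⟩
      by_contra! hlt
      obtain ⟨hpx1, hpx2⟩ := hpx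
      have hxu := h1 x hx (by linarith) hlt
      rcases lt_or_ge (s x) (s v) with hxv | hxv
      · have := hmin x hx hxu (by linarith) (by linarith) hxv
        exact hxp (hinj _ _ (by linarith) (by linarith))
      · rcases hcase with ⟨hn, he⟩ | ⟨hn, he⟩ | hn
        · have := hn.1.2.2.2 x hx (by rintro rfl; linarith) ⟨by linarith, hlt.le⟩
          linarith
        · linarith
        · have := hn.1.2.2.2 x hx (by rintro rfl; linarith) ⟨hxv, by linarith⟩
          linarith
    -- A tied point with larger `s` would be hit before `v` in the a-wedge of `u`, or would beat `u`
    -- in the c-sweep of `v`.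
    have hN : NearC s r S p u := by
      refine ⟨hF, fun x hx => ?_⟩
      by_contra! hlt
      have e1 := hF.2.2.2 x hx.1 hx.2.1 hx.2.2.1
      have e2 := hx.2.2.2 u huS hpu hF.2.2.1
      obtain ⟨hpx1, hpx2⟩ := hx.2.2.1
      rcases hcase with ⟨hn, he⟩ | ⟨hn, he⟩ | hn
      · have := hn.1.2.2.2 x hx.1 (by rintro rfl; linarith) ⟨by linarith, by linarith⟩
        linarith
      · linarith
      · rcases lt_or_ge (s x) (s v) with hxv | hxv
        · linarith
        · have := hn.2 x ⟨hx.1, by rintro rfl; linarith, ⟨hxv, by linarith⟩,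
            fun y hy hyv hvy => (hn.1.2.2.2 y hy hyv hvy).trans e2⟩
          linarith
    have := hfirst p ⟨⟨hpu, Or.inr ⟨hpS, Or.inr (Or.inr hN)⟩⟩, ⟨hp2, by linarith⟩, hF.2.2.1⟩
      (by rintro rfl; linarith)
    unfold turn at this
    nlinarith [mul_nonneg (sub_nonneg.2 hvu.2) (sub_nonneg.2 hp4.le),
      mul_nonneg (sub_nonneg.2 hvu.1) (sub_nonneg.2 hp3.le),
      mul_nonneg (sub_nonneg.2 hp4.le) (sub_nonneg.2 hs.le)]
  refine ⟨hvS, htS, htv, fun p hp hp1 hp2 => ?_⟩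
  by_contra! hlt
  rcases lt_or_ge (s p + r p) (s u + r u) with hpu | hpu
  · have := h1 p hp hp1 (by linarith)
    linarith
  · exact hT p hp hpu hp1 hlt (by linarith)

theorem RightState.exists_inA (hinj : ∀ p q : V, s p = s q → r p = r q → p = q) {t u p : V}
    (h : RightState s r S t u) (hno : ¬ ∃ v, CandC s r S t u v) (hp : p ∈ S) (hpu : p ≠ u)
    (htp : InC s r t p) (hpu' : InC s r p u) :
    ∃ x ∈ S, x ≠ u ∧ InA s r u x ∧ s x + r x ≤ s p + r p := by
  classical
  obtain ⟨huS, htS, htu, h1⟩ := h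
  obtain ⟨q, hq, hmin⟩ := (S.filter fun q => q ≠ u ∧ InC s r t q ∧ InC s r q u ∧
      s q + r q ≤ s p + r p).exists_min_image r ⟨p, by simp [*]⟩
  simp only [Finset.mem_filter, and_imp] at hq hmin
  obtain ⟨hqS, hqu, htq, hqu', hqp⟩ := hq
  by_contra! hcon
  have hF : FirstC s r S q u := by
    refine ⟨huS, hqu.symm, hqu', fun x hx hxq hqx => ?_⟩
    by_contra! hlt
    have hxu := h1 x hx (htq.1.trans hqx.1) hlt
    have hxu' : x ≠ u := by rintro rfl; exact lt_irrefl _ hlt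
    have hxp : s x + r x ≤ s p + r p := hqx.2.trans hqp
    rcases lt_or_ge (s u) (s x) with hr | hr
    · exact absurd (hcon x hx hxu' ⟨hr.le, hlt.le⟩) (not_lt.2 hxp)
    · have := hmin x hx hxu' ⟨htq.1.trans hqx.1, hqx.2.trans htq.2⟩ ⟨hr, hxu⟩ hxp
      have e1 := hqx.1
      have e2 := hqx.2
      exact hxq (hinj _ _ (by linarith) (by linarith))
  -- A tied point with larger `s` is in the a-wedge of `u` and not higher than `p`, which `hcon`
  -- forbids.
  have hN : NearC s r S q u := by
    refine ⟨hF, fun x hx => ?_⟩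
    by_contra! hlt
    have e2 := hx.2.2.2 u huS hqu.symm hqu'
    exact absurd (hcon x hx.1 (by rintro rfl; linarith) ⟨hlt.le, e2⟩)
      (not_lt.2 (hx.2.2.1.2.trans hqp))
  exact hno ⟨q, ⟨hqu.symm, Or.inr ⟨hqS, Or.inr (Or.inr hN)⟩⟩, htq, hqu'⟩

theorem RightState.of_nearA (hinj : ∀ p q : V, s p = s q → r p = r q → p = q) {t u w : V}
    (h : RightState s r S t u) (hne : u ≠ t) (hno : ¬ ∃ v, CandC s r S t u v)
    (hw : NearA s r S u w) : RightState s r S t w := by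
  have key : ∀ {p : V}, p ∈ S → p ≠ u → InC s r t p → InC s r p u → s w + r w ≤ s p + r p := by
    intro p hp hpu h3 h4
    obtain ⟨x, hx, hxu, hux, hxp⟩ := h.exists_inA hinj hno hp hpu h3 h4
    exact (hw.1.2.2.2 x hx hxu hux).trans hxp
  obtain ⟨huS, htS, htu, h1⟩ := h
  obtain ⟨⟨hwS, hwu, ⟨hw1, hw2⟩, hwmin⟩, hwtie⟩ := hw
  have hwt := key htS hne.symm ⟨le_rfl, le_rfl⟩ htu
  simp only [InC] at htu
  refine ⟨hwS, htS, ⟨by linarith, hwt⟩, fun p hp hp1 hp2 => ?_⟩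
  by_contra! hlt
  rcases lt_or_ge (s p + r p) (s u + r u) with hpu | hpu
  · have := h1 p hp hp1 (by linarith)
    linarith
  · have hpe : p ≠ u := by rintro rfl; linarith
    rcases lt_or_ge (s p) (s u) with hr | hr
    · have := key hp hpe ⟨hp1, by linarith⟩ ⟨hr.le, hpu⟩
      linarith
    · have := hwmin p hp hpe ⟨hr, by linarith⟩
      linarith

/-! ### The states of the algorithm -/

/-- The region that must be empty at `w` lies in the a-wedge of `u`, since `t` is interior to that
wedge, and the sweep reached `w` first. As `w` is not higher than `t`, crossing a side of the wedge
puts it in the b- or c-wedge of `t`. -/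
theorem InnerState.of_nearA {t u w : V}
    (h : InnerState s r S t u) (hw : NearA s r S u w) :
    InnerState s r S t w ∨ LeftState s r S t w ∨ RightState s r S t w := by
  obtain ⟨huS, htS, hs, hr⟩ := h
  obtain ⟨⟨hwS, hwu, ⟨hw1, hw2⟩, hwmin⟩, hwtie⟩ := hw
  have hwt := hwmin t htS (by rintro rfl; linarith) ⟨hs.le, hr.le⟩
  by_cases h1 : r t ≤ r w
  · refine Or.inr (Or.inl ⟨hwS, htS, ⟨h1, hwt⟩, fun p hp hp1 hp2 => ?_, fun p hp htp hF =>
      ⟨hF, fun x hx => ?_⟩⟩)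
    · exact hwmin p hp (by rintro rfl; linarith) ⟨by linarith, by linarith⟩
    · have e2 := hx.2.2.2 w hwS hF.2.1 hF.2.2.1
      have e1 := hF.2.2.2 x hx.1 hx.2.1 hx.2.2.1
      have e3 := htp.1.trans hx.2.2.1.1
      have := hwmin x hx.1 (by rintro rfl; linarith) ⟨by linarith, by linarith⟩
      linarith
  · by_cases h2 : s t ≤ s w
    · exact Or.inr (Or.inr ⟨hwS, htS, ⟨h2, hwt⟩, fun p hp hp1 hp2 =>
        hwmin p hp (by rintro rfl; linarith) ⟨by linarith, by linarith⟩⟩)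
    · exact Or.inl ⟨hwS, htS, not_le.1 h2, not_le.1 h1⟩

/-- If `t` is on the boundary of the a-wedge, then `r u = r t` or `s u = s t`, and the region that
must be empty is empty for trivial reasons. -/
theorem state_of_inA {t u : V} (hu : u ∈ S) (ht : t ∈ S) (h : InA s r u t) :
    InnerState s r S t u ∨ LeftState s r S t u ∨ RightState s r S t u := by
  obtain ⟨h1, h2⟩ := h
  by_cases hr : r t ≤ r u
  · refine Or.inr (Or.inl ⟨hu, ht, ⟨hr, by linarith⟩, fun p hp hp1 hp2 => by linarith,
      fun p hp htp hF => ⟨hF, fun x hx => ?_⟩⟩)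
    have := htp.1.trans hx.2.2.1.1
    linarith
  · by_cases hs : s t ≤ s u
    · exact Or.inr (Or.inr ⟨hu, ht, ⟨hs, by linarith⟩, fun p hp hp1 hp2 => by linarith⟩)
    · exact Or.inl ⟨hu, ht, not_le.1 hs, not_le.1 hr⟩

end Abstract

section Abstract

variable {V : Type*} (s r : V → ℝ) (S : Finset V)

/-- A step of the routing algorithm. -/
def Step (t u w : V) : Prop :=
  ((s u < s t ∧ r u < r t) ∧ NearA s r S u w) ∨
  (¬ (s u < s t ∧ r u < r t) ∧ InB s r t u ∧ StepB s r S t u w) ∨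
  (¬ (s u < s t ∧ r u < r t) ∧ ¬ InB s r t u ∧ StepC s r S t u w)

/-- The configurations that occur during the execution of the routing algorithm. -/
def State (t u : V) : Prop :=
  InnerState s r S t u ∨ LeftState s r S t u ∨ RightState s r S t u

/-- `p` is first hit in one of the three reflected wedges of `q`. -/
def NegFirst (q p : V) : Prop :=
  p ∈ S ∧ p ≠ q ∧
    ((InA s r p q ∧ ∀ x ∈ S, x ≠ q → InA s r x q → s x + r x ≤ s p + r p) ∨
     (InB s r p q ∧ ∀ x ∈ S, x ≠ q → InB s r x q → s p ≤ s x) ∨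
     (InC s r p q ∧ ∀ x ∈ S, x ≠ q → InC s r x q → r p ≤ r x))

/-- In none of the wedges of points of `S` two points are hit first. -/
def TieFree : Prop :=
  ∀ q ∈ S, ∀ p p', (FirstA s r S q p → FirstA s r S q p' → p = p') ∧
    (FirstB s r S q p → FirstB s r S q p' → p = p') ∧
    (FirstC s r S q p → FirstC s r S q p' → p = p')

variable {s r S}

theorem State.mem {t u : V} (h : State s r S t u) : u ∈ S := by
  rcases h with h | h | h <;> exact h.1

theorem LeftState.inner_not {t u : V} (h : LeftState s r S t u) :
    ¬ (s u < s t ∧ r u < r t) := fun h' => by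
  have := h.2.2.1.1
  linarith

theorem RightState.inner_not {t u : V} (h : RightState s r S t u) :
    ¬ (s u < s t ∧ r u < r t) := fun h' => by
  have := h.2.2.1.1
  linarith

theorem RightState.inB_not (hinj : ∀ p q : V, s p = s q → r p = r q → p = q) {t u : V}
    (h : RightState s r S t u) (hne : u ≠ t) : ¬ InB s r t u := fun h' => by
  obtain ⟨h1, h2⟩ := h.2.2.1
  obtain ⟨h3, h4⟩ := h'
  exact hne (hinj _ _ (by linarith) (by linarith))

theorem NearA.unique (hinj : ∀ p q : V, s p = s q → r p = r q → p = q) {q p p' : V}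
    (h : NearA s r S q p) (h' : NearA s r S q p') : p = p' := by
  have e1 := h.2 p' h'.1
  have e2 := h'.2 p h.1
  have e3 := h.1.2.2.2 p' h'.1.1 h'.1.2.1 h'.1.2.2.1
  have e4 := h'.1.2.2.2 p h.1.1 h.1.2.1 h.1.2.2.1
  exact hinj _ _ (by linarith) (by linarith)

theorem NearA.sweepAdj {u w : V} (hu : u ∈ S) (h : NearA s r S u w) : SweepAdj s r S u w :=
  ⟨h.1.2.1.symm, Or.inl ⟨hu, Or.inl h⟩⟩

theorem NearA.lt (hinj : ∀ p q : V, s p = s q → r p = r q → p = q) {u w : V}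
    (h : NearA s r S u w) : s u ≤ s w ∧ r u ≤ r w ∧ s u + r u < s w + r w := by
  obtain ⟨h1, h2⟩ := h.1.2.2.1
  refine ⟨h1, h2, lt_of_not_ge fun h3 => h.1.2.1 (hinj _ _ (by linarith) (by linarith))⟩

theorem LeftState.step (hinj : ∀ p q : V, s p = s q → r p = r q → p = q) {t u w : V}
    (h : LeftState s r S t u) (hne : u ≠ t) (hw : Step s r S t u w) :
    LeftState s r S t w ∧ SweepAdj s r S u w ∧ s u ≤ s w ∧ s u + r u ≤ s w + r w ∧
      2 * s u + r u < 2 * s w + r w := by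
  rcases hw with ⟨h', -⟩ | ⟨-, -, hw⟩ | ⟨-, h', -⟩
  · exact absurd h' h.inner_not
  · rcases hw with ⟨hc, hf⟩ | ⟨hno, hw⟩
    · have h1 := (hc.cases hinj).2.2.1
      have h2 := hc.2.2.2
      exact ⟨h.of_first hinj hc hf, hc.1, h1.le, h2, by linarith⟩
    · obtain ⟨h1, h2, h3⟩ := hw.lt hinj
      exact ⟨h.of_nearA hinj hne hno hw, hw.sweepAdj h.1, h1, h3.le, by linarith⟩
  · exact absurd h.2.2.1 h'

theorem RightState.step (hinj : ∀ p q : V, s p = s q → r p = r q → p = q) {t u w : V}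
    (h : RightState s r S t u) (hne : u ≠ t) (hw : Step s r S t u w) :
    RightState s r S t w ∧ SweepAdj s r S u w ∧ r u ≤ r w ∧ s u + r u ≤ s w + r w ∧
      s u + 2 * r u < s w + 2 * r w := by
  rcases hw with ⟨h', -⟩ | ⟨-, h', -⟩ | ⟨-, -, hw⟩
  · exact absurd h' h.inner_not
  · exact absurd h' (h.inB_not hinj hne)
  · rcases hw with ⟨hc, hf⟩ | ⟨hno, hw⟩
    · have h1 := (hc.cases hinj).2.2.1
      have h2 := hc.2.2.2
      exact ⟨h.of_first hinj hc hf, hc.1, h1.le, h2, by linarith⟩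
    · obtain ⟨h1, h2, h3⟩ := hw.lt hinj
      exact ⟨h.of_nearA hinj hne hno hw, hw.sweepAdj h.1, h2, h3.le, by linarith⟩

theorem InnerState.step (hinj : ∀ p q : V, s p = s q → r p = r q → p = q) {t u w : V}
    (h : InnerState s r S t u) (hw : Step s r S t u w) :
    State s r S t w ∧ SweepAdj s r S u w ∧ s u ≤ s w ∧ r u ≤ r w ∧ s u + r u < s w + r w := by
  rcases hw with ⟨-, hw⟩ | ⟨h', -⟩ | ⟨h', -⟩
  · exact ⟨h.of_nearA hw, hw.sweepAdj h.1, hw.lt hinj⟩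
  · exact absurd h.2.2 h'
  · exact absurd h.2.2 h'

theorem State.sweepAdj (hinj : ∀ p q : V, s p = s q → r p = r q → p = q) {t u w : V}
    (h : State s r S t u) (hne : u ≠ t) (hw : Step s r S t u w) : SweepAdj s r S u w := by
  rcases h with h | h | h
  · exact (h.step hinj hw).2.1
  · exact (h.step hinj hne hw).2.1
  · exact (h.step hinj hne hw).2.1

theorem State.exists_step (hinj : ∀ p q : V, s p = s q → r p = r q → p = q) {t u : V}
    (h : State s r S t u) (hne : u ≠ t) : ∃ w, Step s r S t u w := by
  rcases h with h | h | h
  · obtain ⟨w, hw⟩ := exists_nearA h.2.1 hne.symm ⟨h.2.2.1.le, h.2.2.2.le⟩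
    exact ⟨w, Or.inl ⟨h.2.2, hw⟩⟩
  · suffices hs : ∃ w, StepB s r S t u w from
      hs.imp fun w hw => Or.inr (Or.inl ⟨h.inner_not, h.2.2.1, hw⟩)
    by_cases hc : ∃ v, CandB s r S t u v
    · exact (exists_first_candB hinj hc).imp fun w hw => Or.inl hw
    · obtain ⟨x, hx, hxu, hux, -⟩ := h.exists_inA hinj hc h.2.1 hne.symm ⟨le_rfl, le_rfl⟩ h.2.2.1
      exact (exists_nearA hx hxu hux).imp fun w hw => Or.inr ⟨hc, hw⟩
  · suffices hs : ∃ w, StepC s r S t u w from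
      hs.imp fun w hw => Or.inr (Or.inr ⟨h.inner_not, h.inB_not hinj hne, hw⟩)
    by_cases hc : ∃ v, CandC s r S t u v
    · exact (exists_first_candC hinj hc).imp fun w hw => Or.inl hw
    · obtain ⟨x, hx, hxu, hux, -⟩ := h.exists_inA hinj hc h.2.1 hne.symm ⟨le_rfl, le_rfl⟩ h.2.2.1
      exact (exists_nearA hx hxu hux).imp fun w hw => Or.inr ⟨hc, hw⟩

/-! ### Termination -/

/-- Well-founded induction on the number of points of `S` with larger potential. -/
theorem _root_.Finset.induction_on_potential (φ : V → ℝ) {P : V → Prop}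
    (h : ∀ u ∈ S, (∀ v ∈ S, φ u < φ v → P v) → P u) : ∀ u ∈ S, P u := by
  classical
  suffices hn : ∀ n : ℕ, ∀ u ∈ S, (S.filter fun v => φ u < φ v).card = n → P u from
    fun u hu => hn _ u hu rfl
  intro n
  induction n using Nat.strong_induction_on with
  | _ n ih =>
    intro u hu hn
    refine h u hu fun v hv huv => ih _ ?_ v hv rfl
    rw [← hn]
    refine Finset.card_lt_card ⟨fun x hx => ?_, fun hsub => ?_⟩
    · simp only [Finset.mem_filter] at hx ⊢
      exact ⟨hx.1, huv.trans hx.2⟩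
    · have := hsub (Finset.mem_filter.2 ⟨hv, huv⟩)
      simp at this

/-- Iterating `f` from `q` leads to `t` through vertices satisfying `P` and along edges
satisfying `E`. -/
def Reaches (f : V → V) (t : V) (P : V → Prop) (E : V → V → Prop) (q : V) : Prop :=
  ∃ m : ℕ, f^[m] q = t ∧ ∀ j < m, f^[j] q ≠ t ∧ P (f^[j] q) ∧ E (f^[j] q) (f^[j + 1] q)

theorem Reaches.refl (f : V → V) (t : V) (P : V → Prop) (E : V → V → Prop) :
    Reaches f t P E t := ⟨0, rfl, by simp⟩

theorem Reaches.cons {f : V → V} {t : V} {P : V → Prop} {E : V → V → Prop} {q : V}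
    (h : Reaches f t P E (f q)) (hne : q ≠ t) (hP : P q) (hE : E q (f q)) :
    Reaches f t P E q := by
  obtain ⟨m, hm, hj⟩ := h
  refine ⟨m + 1, hm, fun j hjm => ?_⟩
  cases j with
  | zero => exact ⟨hne, hP, hE⟩
  | succ j => exact hj j (by omega)

variable (s r) in
/-- The edge directions of left routing. -/
def LeftEdge (u w : V) : Prop := s u ≤ s w ∧ s u + r u ≤ s w + r w

variable (s r) in
/-- The edge directions of right routing. -/
def RightEdge (u w : V) : Prop := r u ≤ r w ∧ s u + r u ≤ s w + r w

/-- Left and right routing are never left again, and the inner steps before them satisfy both edge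
conditions, so one condition holds along the whole path. -/
theorem State.reaches (hinj : ∀ p q : V, s p = s q → r p = r q → p = q) {t : V} {f : V → V}
    (hf : ∀ u, State s r S t u → u ≠ t → Step s r S t u (f u)) {q : V} (hq : State s r S t q) :
    Reaches f t (State s r S t) (LeftEdge s r) q ∨
      Reaches f t (State s r S t) (RightEdge s r) q := by
  have hL : ∀ u ∈ S, LeftState s r S t u → Reaches f t (State s r S t) (LeftEdge s r) u := by
    -- The potential is `s` plus the height: `s` grows strictly along candidates, the height along
    -- a-steps.
    refine Finset.induction_on_potential (fun u => 2 * s u + r u) fun u hu ih h => ?_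
    by_cases hne : u = t
    · exact hne ▸ Reaches.refl _ _ _ _
    · obtain ⟨h1, -, h3, h4, h5⟩ := h.step hinj hne (hf u (Or.inr (Or.inl h)) hne)
      exact (ih _ h1.1 h5 h1).cons hne (Or.inr (Or.inl h)) ⟨h3, h4⟩
  have hR : ∀ u ∈ S, RightState s r S t u → Reaches f t (State s r S t) (RightEdge s r) u := by
    refine Finset.induction_on_potential (fun u => s u + 2 * r u) fun u hu ih h => ?_
    by_cases hne : u = t
    · exact hne ▸ Reaches.refl _ _ _ _
    · obtain ⟨h1, -, h3, h4, h5⟩ := h.step hinj hne (hf u (Or.inr (Or.inr h)) hne)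
      exact (ih _ h1.1 h5 h1).cons hne (Or.inr (Or.inr h)) ⟨h3, h4⟩
  have hS : ∀ u ∈ S, State s r S t u → Reaches f t (State s r S t) (LeftEdge s r) u ∨
      Reaches f t (State s r S t) (RightEdge s r) u := by
    refine Finset.induction_on_potential (fun u => s u + r u) fun u hu ih h => ?_
    rcases h with h | h | h
    · have hne : u ≠ t := by
        rintro rfl
        exact lt_irrefl _ h.2.2.1
      obtain ⟨h1, -, h3, h4, h5⟩ := h.step hinj (hf u (Or.inl h) hne)
      exact (ih _ h1.mem h5 h1).imp (fun h' => h'.cons hne (Or.inl h) ⟨h3, h5.le⟩)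
        fun h' => h'.cons hne (Or.inl h) ⟨h4, h5.le⟩
    · exact Or.inl (hL u hu h)
    · exact Or.inr (hR u hu h)
  exact hS q hq.mem hq

/-! ### Locality -/

theorem StepB.unique {S' : Finset V} (hinj : ∀ p q : V, s p = s q → r p = r q → p = q)
    {t u w w' : V} (hA : ∀ x, NearA s r S u x → NearA s r S' u x)
    (hc : ∀ v, CandB s r S t u v ↔ CandB s r S' t u v)
    (h : StepB s r S t u w) (h' : StepB s r S' t u w') : w = w' := by
  simp only [StepB, ← hc] at h'
  rcases h with ⟨h1, h2⟩ | ⟨h1, h2⟩ <;> rcases h' with ⟨h3, h4⟩ | ⟨h3, h4⟩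
  · by_contra hne
    have e1 := h2 _ h3 (Ne.symm hne)
    have e2 := h4 _ h1 hne
    unfold turn at e1 e2
    linarith
  · exact absurd ⟨w, h1⟩ h3
  · exact absurd ⟨w', h3⟩ h1
  · exact (hA _ h2).unique hinj h4

theorem StepC.unique {S' : Finset V} (hinj : ∀ p q : V, s p = s q → r p = r q → p = q)
    {t u w w' : V} (hA : ∀ x, NearA s r S u x → NearA s r S' u x)
    (hc : ∀ v, CandC s r S t u v ↔ CandC s r S' t u v)
    (h : StepC s r S t u w) (h' : StepC s r S' t u w') : w = w' := by
  simp only [StepC, ← hc] at h'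
  rcases h with ⟨h1, h2⟩ | ⟨h1, h2⟩ <;> rcases h' with ⟨h3, h4⟩ | ⟨h3, h4⟩
  · by_contra hne
    have e1 := h2 _ h3 (Ne.symm hne)
    have e2 := h4 _ h1 hne
    unfold turn at e1 e2
    linarith
  · exact absurd ⟨w, h1⟩ h3
  · exact absurd ⟨w', h3⟩ h1
  · exact (hA _ h2).unique hinj h4

theorem Step.unique {S' : Finset V} (hinj : ∀ p q : V, s p = s q → r p = r q → p = q)
    {t u w w' : V} (hA : ∀ x, NearA s r S u x → NearA s r S' u x)
    (hB : InB s r t u → ∀ v, CandB s r S t u v ↔ CandB s r S' t u v)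
    (hC : ¬ (s u < s t ∧ r u < r t) → ¬ InB s r t u →
      ∀ v, CandC s r S t u v ↔ CandC s r S' t u v)
    (h : Step s r S t u w) (h' : Step s r S' t u w') : w = w' := by
  rcases h with ⟨h1, h2⟩ | ⟨h0, h1, h2⟩ | ⟨h0, h1, h2⟩ <;>
    rcases h' with ⟨h3, h4⟩ | ⟨h5, h3, h4⟩ | ⟨h5, h3, h4⟩
  · exact (hA _ h2).unique hinj h4
  · exact absurd h1 h5
  · exact absurd h1 h5
  · exact absurd h3 h0
  · exact h2.unique hinj hA (hB h1) h4
  · exact absurd h1 h3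
  · exact absurd h3 h0
  · exact absurd h3 h1
  · exact h2.unique hinj hA (hC h0 h1) h4

/-! ### What a neighbourhood in the union graph determines -/

section Views

variable {S' : Finset V} {G G' : SimpleGraph V}

/-- The nearest neighbours of `u` in `S` and in `S'` are visible in both graphs, so both belong to
both sets. Each competes in the sweep won by the other, and they coincide. -/
theorem NearA.of_view (hinj : ∀ p q : V, s p = s q → r p = r q → p = q)
    (hG : ∀ a b, SweepAdj s r S a b → G.Adj a b) (hS : ∀ a b, G.Adj a b → b ∈ S)
    (hG' : ∀ a b, SweepAdj s r S' a b → G'.Adj a b) (hS' : ∀ a b, G'.Adj a b → b ∈ S')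
    {u w : V} (hu : u ∈ S) (hu' : u ∈ S') (hN : ∀ v, G.Adj u v ↔ G'.Adj u v)
    (h : NearA s r S u w) : NearA s r S' u w := by
  have hw' : w ∈ S' := hS' u w ((hN w).1 (hG u w ⟨h.1.2.1.symm, Or.inl ⟨hu, Or.inl h⟩⟩))
  obtain ⟨x, hx⟩ := exists_nearA hw' h.1.2.1 h.1.2.2.1
  have hxS : x ∈ S := hS u x ((hN x).2 (hG' u x ⟨hx.1.2.1.symm, Or.inl ⟨hu', Or.inl hx⟩⟩))
  have e1 := h.1.2.2.2 x hxS hx.1.2.1 hx.1.2.2.1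
  have e2 := hx.1.2.2.2 w hw' h.1.2.1 h.1.2.2.1
  have e3 := h.2 x ⟨hxS, hx.1.2.1, hx.1.2.2.1, fun y hy h1 h2 => e2.trans (h.1.2.2.2 y hy h1 h2)⟩
  have e4 := hx.2 w ⟨hw', h.1.2.1, h.1.2.2.1, fun y hy h1 h2 => e1.trans (hx.1.2.2.2 y hy h1 h2)⟩
  exact hinj x w (by linarith) (by linarith) ▸ hx

theorem NearB.of_view (hinj : ∀ p q : V, s p = s q → r p = r q → p = q)
    (hG : ∀ a b, SweepAdj s r S a b → G.Adj a b) (hS : ∀ a b, G.Adj a b → b ∈ S)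
    (hG' : ∀ a b, SweepAdj s r S' a b → G'.Adj a b) (hS' : ∀ a b, G'.Adj a b → b ∈ S')
    {u w : V} (hu : u ∈ S) (hu' : u ∈ S') (hN : ∀ v, G.Adj u v ↔ G'.Adj u v)
    (h : NearB s r S u w) : NearB s r S' u w := by
  have hw' : w ∈ S' := hS' u w
    ((hN w).1 (hG u w ⟨h.1.2.1.symm, Or.inl ⟨hu, Or.inr (Or.inl h)⟩⟩))
  obtain ⟨x, hx⟩ := exists_nearB hw' h.1.2.1 h.1.2.2.1
  have hxS : x ∈ S := hS u x
    ((hN x).2 (hG' u x ⟨hx.1.2.1.symm, Or.inl ⟨hu', Or.inr (Or.inl hx)⟩⟩))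
  have e1 := h.1.2.2.2 x hxS hx.1.2.1 hx.1.2.2.1
  have e2 := hx.1.2.2.2 w hw' h.1.2.1 h.1.2.2.1
  have e3 := h.2 x ⟨hxS, hx.1.2.1, hx.1.2.2.1, fun y hy h1 h2 => (h.1.2.2.2 y hy h1 h2).trans e2⟩
  have e4 := hx.2 w ⟨hw', h.1.2.1, h.1.2.2.1, fun y hy h1 h2 => (hx.1.2.2.2 y hy h1 h2).trans e1⟩
  exact hinj x w (by linarith) (by linarith) ▸ hx

theorem NearC.of_view (hinj : ∀ p q : V, s p = s q → r p = r q → p = q)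
    (hG : ∀ a b, SweepAdj s r S a b → G.Adj a b) (hS : ∀ a b, G.Adj a b → b ∈ S)
    (hG' : ∀ a b, SweepAdj s r S' a b → G'.Adj a b) (hS' : ∀ a b, G'.Adj a b → b ∈ S')
    {u w : V} (hu : u ∈ S) (hu' : u ∈ S') (hN : ∀ v, G.Adj u v ↔ G'.Adj u v)
    (h : NearC s r S u w) : NearC s r S' u w := by
  have hw' : w ∈ S' := hS' u w
    ((hN w).1 (hG u w ⟨h.1.2.1.symm, Or.inl ⟨hu, Or.inr (Or.inr h)⟩⟩))
  obtain ⟨x, hx⟩ := exists_nearC hw' h.1.2.1 h.1.2.2.1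
  have hxS : x ∈ S := hS u x
    ((hN x).2 (hG' u x ⟨hx.1.2.1.symm, Or.inl ⟨hu', Or.inr (Or.inr hx)⟩⟩))
  have e1 := h.1.2.2.2 x hxS hx.1.2.1 hx.1.2.2.1
  have e2 := hx.1.2.2.2 w hw' h.1.2.1 h.1.2.2.1
  have e3 := h.2 x ⟨hxS, hx.1.2.1, hx.1.2.2.1, fun y hy h1 h2 => (h.1.2.2.2 y hy h1 h2).trans e2⟩
  have e4 := hx.2 w ⟨hw', h.1.2.1, h.1.2.2.1, fun y hy h1 h2 => (hx.1.2.2.2 y hy h1 h2).trans e1⟩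
  exact hinj x w (by linarith) (by linarith) ▸ hx

/-- An edge selected by `v` rather than by `u` can only be recognized from the neighbours of `v`;
this is where the second neighbourhood is used. -/
theorem SweepAdj.of_view (hinj : ∀ p q : V, s p = s q → r p = r q → p = q)
    (hG : ∀ a b, SweepAdj s r S a b → G.Adj a b) (hS : ∀ a b, G.Adj a b → b ∈ S)
    (hG' : ∀ a b, SweepAdj s r S' a b → G'.Adj a b) (hS' : ∀ a b, G'.Adj a b → b ∈ S')
    {u v : V} (hu' : u ∈ S') (hN : ∀ v, G.Adj u v ↔ G'.Adj u v)
    (hN2 : ∀ v, G.Adj u v → ∀ x, G.Adj v x ↔ G'.Adj v x)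
    (h : SweepAdj s r S u v) : SweepAdj s r S' u v := by
  have huv := hG _ _ h
  have hv' := hS' _ _ ((hN v).1 huv)
  obtain ⟨hne, h⟩ := h
  refine ⟨hne, h.imp ?_ ?_⟩
  · rintro ⟨hu, h⟩
    exact ⟨hu', h.imp (NearA.of_view hinj hG hS hG' hS' hu hu' hN)
      (Or.imp (NearB.of_view hinj hG hS hG' hS' hu hu' hN)
        (NearC.of_view hinj hG hS hG' hS' hu hu' hN))⟩
  · rintro ⟨hv, h⟩
    exact ⟨hv', h.imp (NearA.of_view hinj hG hS hG' hS' hv hv' (hN2 v huv))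
      (Or.imp (NearB.of_view hinj hG hS hG' hS' hv hv' (hN2 v huv))
        (NearC.of_view hinj hG hS hG' hS' hv hv' (hN2 v huv)))⟩

/-- A step of the algorithm is determined by the `2`-neighbourhood. -/
theorem Step.unique_of_view_two (hinj : ∀ p q : V, s p = s q → r p = r q → p = q)
    (hG : ∀ a b, SweepAdj s r S a b → G.Adj a b) (hS : ∀ a b, G.Adj a b → b ∈ S)
    (hG' : ∀ a b, SweepAdj s r S' a b → G'.Adj a b) (hS' : ∀ a b, G'.Adj a b → b ∈ S')
    {t u w w' : V} (hu : u ∈ S) (hu' : u ∈ S') (hN : ∀ v, G.Adj u v ↔ G'.Adj u v)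
    (hN2 : ∀ v, G.Adj u v → ∀ x, G.Adj v x ↔ G'.Adj v x)
    (h : Step s r S t u w) (h' : Step s r S' t u w') : w = w' := by
  have hadj : ∀ v, SweepAdj s r S u v ↔ SweepAdj s r S' u v := fun v =>
    ⟨SweepAdj.of_view hinj hG hS hG' hS' hu' hN hN2,
      SweepAdj.of_view hinj hG' hS' hG hS hu (fun v => (hN v).symm)
        fun v hv x => (hN2 v ((hN v).2 hv) x).symm⟩
  exact h.unique hinj (fun x => NearA.of_view hinj hG hS hG' hS' hu hu' hN)
    (fun _ v => by simp only [CandB, hadj]) (fun _ _ v => by simp only [CandC, hadj]) h'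

/-- In the absence of ties, candidates for left routing are recognized by the neighbours of the
current vertex in the union of the 3-sweep graph and its reflection. -/
theorem LeftState.candB_iff (hinj : ∀ p q : V, s p = s q → r p = r q → p = q)
    (hties : TieFree s r S) (hG : ∀ a b, SweepAdj s r S a b → G.Adj a b)
    (hS : ∀ a b, G.Adj a b → b ∈ S)
    (hneg : ∀ a b, G.Adj a b → SweepAdj s r S a b ∨ NegFirst s r S a b ∨ NegFirst s r S b a)
    {t u : V} (h : LeftState s r S t u) (v : V) :
    CandB s r S t u v ↔ G.Adj u v ∧ InB s r t v ∧ InB s r v u ∧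
      ∀ w, G.Adj u w → InA s r u w → w ≠ v → s v + r v < s w + r w := by
  obtain ⟨huS, htS, htu, h1, h2⟩ := h
  constructor
  · intro hc
    refine ⟨hG _ _ hc.1, hc.2.1, hc.2.2, fun w hw huw hwv => ?_⟩
    obtain ⟨⟨-, hvS⟩, hne, hs, hcase⟩ := hc.cases hinj
    obtain ⟨-, htv, hvu1, hvu2⟩ := hc
    have hwS := hS _ _ hw
    obtain ⟨huw1, huw2⟩ := huw
    -- Such a `w` would tie with `v` in the a-sweep of `u`, or with `u` in the b-sweep of `v`.
    by_contra! hle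
    rcases hcase with ⟨hn, he⟩ | ⟨hn, he⟩ | hn
    · refine hwv ((hties u huS w v).1 ⟨hwS, hw.ne.symm, ⟨huw1, huw2⟩, fun x hx hxu hux => ?_⟩ hn.1)
      exact hle.trans (hn.1.2.2.2 x hx hxu hux)
    · exact hw.ne (hinj _ _ (by linarith) (by linarith))
    · refine hw.ne ((hties v hvS u w).2.1 hn.1 ⟨hwS, hwv, ⟨by linarith, hle⟩,
        fun x hx hxv hvx => (hn.1.2.2.2 x hx hxv hvx).trans huw1⟩)
  · rintro ⟨hadj, htv, hvu, hcrit⟩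
    have hvS := hS _ _ hadj
    refine ⟨?_, htv, hvu⟩
    by_contra hna
    obtain ⟨hvu1, hvu2⟩ := hvu
    -- A point `x` that beats `u` is not lower than `u`. If it is in the a-wedge of `u`, the
    -- a-neighbour of `u` violates `hcrit`; if `r x < r u`, then `x` contradicts each way in which a
    -- reflected wedge could have produced the edge `uv`.
    have hF : FirstB s r S v u := by
      refine ⟨huS, hadj.ne, ⟨hvu1, hvu2⟩, fun x hx hxv hvx => ?_⟩
      by_contra! hlt
      obtain ⟨hvx1, hvx2⟩ := hvx
      have hxu := h1 x hx (htv.1.trans hvx1) hlt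
      have hxu' : x ≠ u := by rintro rfl; exact lt_irrefl _ hlt
      rcases le_or_gt (r u) (r x) with hr | hr
      · obtain ⟨w, hw⟩ := exists_nearA hx hxu' ⟨hlt.le, hr⟩
        have hwadj := hw.sweepAdj huS
        by_cases hwv : w = v
        · exact hna (hwv ▸ hwadj)
        · have e1 := hcrit w (hG _ _ hwadj) hw.1.2.2.1 hwv
          have e2 := hw.1.2.2.2 x hx hxu' ⟨hlt.le, hr⟩
          linarith
      · rcases hneg _ _ hadj with h' | ⟨-, -, ⟨⟨h3, h4⟩, h'⟩ | ⟨⟨h3, h4⟩, h'⟩ | ⟨⟨h3, h4⟩, h'⟩⟩ |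
          ⟨-, -, ⟨⟨h3, h4⟩, h'⟩ | ⟨⟨h3, h4⟩, h'⟩ | ⟨⟨h3, h4⟩, h'⟩⟩
        · exact hna h'
        · exact hadj.ne (hinj _ _ (by linarith) (by linarith))
        · have := h' x hx hxu' ⟨hr.le, hxu⟩
          exact hxv (hinj _ _ (by linarith) (by linarith))
        · exact hadj.ne (hinj _ _ (by linarith) (by linarith))
        · linarith
        · exact hadj.ne (hinj _ _ (by linarith) (by linarith))
        · have := h' x hx hxv ⟨by linarith, by linarith⟩
          linarith
    exact hna ⟨hadj.ne, Or.inr ⟨hvS, Or.inr (Or.inl ⟨hF, fun x hx =>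
      ((hties v hvS u x).2.1 hF hx ▸ le_rfl)⟩)⟩⟩

theorem RightState.candC_iff (hinj : ∀ p q : V, s p = s q → r p = r q → p = q)
    (hties : TieFree s r S) (hG : ∀ a b, SweepAdj s r S a b → G.Adj a b)
    (hS : ∀ a b, G.Adj a b → b ∈ S)
    (hneg : ∀ a b, G.Adj a b → SweepAdj s r S a b ∨ NegFirst s r S a b ∨ NegFirst s r S b a)
    {t u : V} (h : RightState s r S t u) (v : V) :
    CandC s r S t u v ↔ G.Adj u v ∧ InC s r t v ∧ InC s r v u ∧
      ∀ w, G.Adj u w → InA s r u w → w ≠ v → s v + r v < s w + r w := by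
  obtain ⟨huS, htS, htu, h1⟩ := h
  constructor
  · intro hc
    refine ⟨hG _ _ hc.1, hc.2.1, hc.2.2, fun w hw huw hwv => ?_⟩
    obtain ⟨⟨-, hvS⟩, hne, hs, hcase⟩ := hc.cases hinj
    obtain ⟨-, htv, hvu1, hvu2⟩ := hc
    have hwS := hS _ _ hw
    obtain ⟨huw1, huw2⟩ := huw
    by_contra! hle
    rcases hcase with ⟨hn, he⟩ | ⟨hn, he⟩ | hn
    · refine hwv ((hties u huS w v).1 ⟨hwS, hw.ne.symm, ⟨huw1, huw2⟩, fun x hx hxu hux => ?_⟩ hn.1)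
      exact hle.trans (hn.1.2.2.2 x hx hxu hux)
    · exact hw.ne (hinj _ _ (by linarith) (by linarith))
    · refine hw.ne ((hties v hvS u w).2.2 hn.1 ⟨hwS, hwv, ⟨by linarith, hle⟩,
        fun x hx hxv hvx => (hn.1.2.2.2 x hx hxv hvx).trans huw2⟩)
  · rintro ⟨hadj, htv, hvu, hcrit⟩
    have hvS := hS _ _ hadj
    refine ⟨?_, htv, hvu⟩
    by_contra hna
    obtain ⟨hvu1, hvu2⟩ := hvu
    have hF : FirstC s r S v u := by
      refine ⟨huS, hadj.ne, ⟨hvu1, hvu2⟩, fun x hx hxv hvx => ?_⟩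
      by_contra! hlt
      obtain ⟨hvx1, hvx2⟩ := hvx
      have hxu := h1 x hx (htv.1.trans hvx1) hlt
      have hxu' : x ≠ u := by rintro rfl; exact lt_irrefl _ hlt
      rcases le_or_gt (s u) (s x) with hr | hr
      · obtain ⟨w, hw⟩ := exists_nearA hx hxu' ⟨hr, hlt.le⟩
        have hwadj := hw.sweepAdj huS
        by_cases hwv : w = v
        · exact hna (hwv ▸ hwadj)
        · have e1 := hcrit w (hG _ _ hwadj) hw.1.2.2.1 hwv
          have e2 := hw.1.2.2.2 x hx hxu' ⟨hr, hlt.le⟩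
          linarith
      · rcases hneg _ _ hadj with h' | ⟨-, -, ⟨⟨h3, h4⟩, h'⟩ | ⟨⟨h3, h4⟩, h'⟩ | ⟨⟨h3, h4⟩, h'⟩⟩ |
          ⟨-, -, ⟨⟨h3, h4⟩, h'⟩ | ⟨⟨h3, h4⟩, h'⟩ | ⟨⟨h3, h4⟩, h'⟩⟩
        · exact hna h'
        · exact hadj.ne (hinj _ _ (by linarith) (by linarith))
        · exact hadj.ne (hinj _ _ (by linarith) (by linarith))
        · have := h' x hx hxu' ⟨hr.le, hxu⟩
          exact hxv (hinj _ _ (by linarith) (by linarith))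
        · linarith
        · have := h' x hx hxv ⟨by linarith, by linarith⟩
          linarith
        · exact hadj.ne (hinj _ _ (by linarith) (by linarith))
    exact hna ⟨hadj.ne, Or.inr ⟨hvS, Or.inr (Or.inr ⟨hF, fun x hx =>
      ((hties v hvS u x).2.2 hF hx ▸ le_rfl)⟩)⟩⟩

/-- In the absence of ties, a step of the algorithm is determined by the neighbours of the
current vertex in the union of the 3-sweep graph and its reflection. -/
theorem Step.unique_of_view_one (hinj : ∀ p q : V, s p = s q → r p = r q → p = q)
    (hties : TieFree s r S) (hG : ∀ a b, SweepAdj s r S a b → G.Adj a b)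
    (hS : ∀ a b, G.Adj a b → b ∈ S)
    (hneg : ∀ a b, G.Adj a b → SweepAdj s r S a b ∨ NegFirst s r S a b ∨ NegFirst s r S b a)
    (hties' : TieFree s r S') (hG' : ∀ a b, SweepAdj s r S' a b → G'.Adj a b)
    (hS' : ∀ a b, G'.Adj a b → b ∈ S')
    (hneg' : ∀ a b, G'.Adj a b →
      SweepAdj s r S' a b ∨ NegFirst s r S' a b ∨ NegFirst s r S' b a)
    {t u w w' : V} (hu : State s r S t u) (hu' : State s r S' t u) (hne : u ≠ t)
    (hN : ∀ v, G.Adj u v ↔ G'.Adj u v)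
    (h : Step s r S t u w) (h' : Step s r S' t u w') : w = w' := by
  have left : ∀ {T : Finset V}, State s r T t u → InB s r t u → LeftState s r T t u := by
    rintro T (hT | hT | hT) hb
    · have := hT.2.2.2
      have := hb.1
      linarith
    · exact hT
    · exact absurd hb (hT.inB_not hinj hne)
  have right : ∀ {T : Finset V}, State s r T t u → ¬ (s u < s t ∧ r u < r t) →
      ¬ InB s r t u → RightState s r T t u := by
    rintro T (hT | hT | hT) hi hb
    · exact absurd hT.2.2 hi
    · exact absurd hT.2.2.1 hb
    · exact hT
  refine h.unique hinj (fun x => NearA.of_view hinj hG hS hG' hS' hu.mem hu'.mem hN)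
    (fun hb v => ?_) (fun hi hb v => ?_) h'
  · simp only [(left hu hb).candB_iff hinj hties hG hS hneg,
      (left hu' hb).candB_iff hinj hties' hG' hS' hneg', hN]
  · simp only [(right hu hi hb).candC_iff hinj hties hG hS hneg,
      (right hu' hi hb).candC_iff hinj hties' hG' hS' hneg', hN]

end Views

end Abstract

/-! ### Affine coordinates -/

/-- The coordinate along `B` in the basis `B, C` of the plane. -/
noncomputable def coordB (B C p : Plane) : ℝ := cross p C / cross B C

/-- The coordinate along `C` in the basis `B, C` of the plane. -/
noncomputable def coordC (B C p : Plane) : ℝ := cross B p / cross B C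

theorem plane_ext {p q : Plane} (h0 : p 0 = q 0) (h1 : p 1 = q 1) : p = q := by
  ext i
  fin_cases i
  exacts [h0, h1]

/-- Cramer's rule. -/
theorem coord_spec {B C : Plane} (h : cross B C < 0) (p : Plane) :
    p = coordB B C p • B + coordC B C p • C := by
  have h' : B 0 * C 1 - B 1 * C 0 ≠ 0 := h.ne
  apply plane_ext <;>
    simp only [coordB, coordC, cross, PiLp.add_apply, PiLp.smul_apply, smul_eq_mul] <;>
    rw [div_mul_eq_mul_div, div_mul_eq_mul_div, ← add_div, eq_div_iff h'] <;> ring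

theorem coord_inj {B C : Plane} (h : cross B C < 0) (p q : Plane)
    (h1 : coordB B C p = coordB B C q) (h2 : coordC B C p = coordC B C q) : p = q := by
  rw [coord_spec h p, coord_spec h q, h1, h2]

theorem sub_eq_coord {B C : Plane} (h : cross B C < 0) (p q : Plane) :
    p - q = (coordB B C p - coordB B C q) • B + (coordC B C p - coordC B C q) • C := by
  nth_rw 1 [coord_spec h p, coord_spec h q]
  module

theorem cross_comb (B C : Plane) (a b c d : ℝ) :
    cross (a • B + b • C) (c • B + d • C) = (a * d - b * c) * cross B C := by
  simp [cross]
  ring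

/-- By Cramer's rule the coefficients are quotients of cross products, with negative denominator
because the corners are in clockwise order. -/
theorem mem_wedge_iff {X Y Z : Plane} (h : cross (Y - X) (Z - X) < 0) (q p : Plane) :
    p ∈ wedge X Y Z q ↔ cross (p - q) (Z - X) ≤ 0 ∧ cross (Y - X) (p - q) ≤ 0 := by
  constructor
  · rintro ⟨s, r, hs, hr, rfl⟩
    have e1 : cross (q + s • (Y - X) + r • (Z - X) - q) (Z - X) =
      s * cross (Y - X) (Z - X) := by simp [cross]; ring
    have e2 : cross (Y - X) (q + s • (Y - X) + r • (Z - X) - q) =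
      r * cross (Y - X) (Z - X) := by simp [cross]; ring
    rw [e1, e2]
    exact ⟨mul_nonpos_of_nonneg_of_nonpos hs h.le, mul_nonpos_of_nonneg_of_nonpos hr h.le⟩
  · rintro ⟨h1, h2⟩
    refine ⟨_, _, div_nonneg_of_nonpos h1 h.le, div_nonneg_of_nonpos h2 h.le, ?_⟩
    have := coord_spec h (p - q)
    unfold coordB coordC at this
    rw [add_assoc, ← this]
    abel

/-! ### Translation of the planar definitions into coordinates -/

section Coordinates

variable {B C : Plane} (h : cross B C < 0)
include h

theorem mem_wedge_A (q p : Plane) :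
    p ∈ wedge cornerA B C q ↔ InA (coordB B C) (coordC B C) q p := by
  rw [mem_wedge_iff (by simpa [cornerA] using h), sub_eq_coord h p q]
  have e1 := cross_comb B C (coordB B C p - coordB B C q) (coordC B C p - coordC B C q) 0 1
  have e2 := cross_comb B C 1 0 (coordB B C p - coordB B C q) (coordC B C p - coordC B C q)
  simp only [zero_smul, one_smul, zero_add, add_zero] at e1 e2
  simp only [cornerA, sub_zero, e1, e2, InA]
  constructor
  · rintro ⟨h1, h2⟩
    exact ⟨by nlinarith, by nlinarith⟩
  · rintro ⟨h1, h2⟩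
    exact ⟨by nlinarith, by nlinarith⟩

theorem mem_wedge_B (q p : Plane) :
    p ∈ wedge B C cornerA q ↔ InB (coordB B C) (coordC B C) q p := by
  rw [mem_wedge_iff (by have : cross (C - B) (cornerA - B) = cross B C := by
                          simp [cornerA, cross]; ring
                        rwa [this]), sub_eq_coord h p q]
  have e1 := cross_comb B C (coordB B C p - coordB B C q) (coordC B C p - coordC B C q) (-1) 0
  have e2 := cross_comb B C (-1) 1 (coordB B C p - coordB B C q) (coordC B C p - coordC B C q)
  rw [show (-1 : ℝ) • B + (0 : ℝ) • C = cornerA - B by simp [cornerA]] at e1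
  rw [show (-1 : ℝ) • B + (1 : ℝ) • C = C - B by module] at e2
  simp only [e1, e2, InB]
  constructor
  · rintro ⟨h1, h2⟩
    exact ⟨by nlinarith, by nlinarith⟩
  · rintro ⟨h1, h2⟩
    exact ⟨by nlinarith, by nlinarith⟩

theorem mem_wedge_C (q p : Plane) :
    p ∈ wedge C cornerA B q ↔ InC (coordB B C) (coordC B C) q p := by
  rw [mem_wedge_iff (by have : cross (cornerA - C) (B - C) = cross B C := by
                          simp [cornerA, cross]; ring
                        rwa [this]), sub_eq_coord h p q]
  have e1 := cross_comb B C (coordB B C p - coordB B C q) (coordC B C p - coordC B C q) 1 (-1)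
  have e2 := cross_comb B C 0 (-1) (coordB B C p - coordB B C q) (coordC B C p - coordC B C q)
  rw [show (1 : ℝ) • B + (-1 : ℝ) • C = B - C by module] at e1
  rw [show (0 : ℝ) • B + (-1 : ℝ) • C = cornerA - C by simp [cornerA]] at e2
  simp only [e1, e2, InC]
  constructor
  · rintro ⟨h1, h2⟩
    exact ⟨by nlinarith, by nlinarith⟩
  · rintro ⟨h1, h2⟩
    exact ⟨by nlinarith, by nlinarith⟩

theorem sweepTime_A (q p : Plane) : sweepTime B C q p =
    (coordB B C p + coordC B C p - (coordB B C q + coordC B C q)) * -cross B C := by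
  have e := cross_comb B C (-1) 1 (coordB B C p - coordB B C q) (coordC B C p - coordC B C q)
  rw [show (-1 : ℝ) • B + (1 : ℝ) • C = C - B by module] at e
  rw [sweepTime, sub_eq_coord h p q, e]
  ring

theorem sweepTime_B (q p : Plane) : sweepTime C cornerA q p =
    (coordB B C q - coordB B C p) * -cross B C := by
  have e := cross_comb B C 0 (-1) (coordB B C p - coordB B C q) (coordC B C p - coordC B C q)
  rw [show (0 : ℝ) • B + (-1 : ℝ) • C = cornerA - C by simp [cornerA]] at e
  rw [sweepTime, sub_eq_coord h p q, e]
  ring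

theorem sweepTime_C (q p : Plane) : sweepTime cornerA B q p =
    (coordC B C q - coordC B C p) * -cross B C := by
  have e := cross_comb B C 1 0 (coordB B C p - coordB B C q) (coordC B C p - coordC B C q)
  rw [show (1 : ℝ) • B + (0 : ℝ) • C = B - cornerA by simp [cornerA]] at e
  rw [sweepTime, sub_eq_coord h p q, e]
  ring

theorem cross_sub_eq_turn (u w v : Plane) :
    cross (w - u) (v - u) = turn (coordB B C) (coordC B C) u w v * cross B C := by
  rw [sub_eq_coord h w u, sub_eq_coord h v u, cross_comb, turn]

theorem isFirstHit_A (S : Finset Plane) (q p : Plane) :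
    IsFirstHit cornerA B C S q p ↔ FirstA (coordB B C) (coordC B C) S q p := by
  simp only [IsFirstHit, FirstA, mem_wedge_A h, sweepTime_A h,
    mul_le_mul_iff_left₀ (neg_pos.2 h), sub_le_sub_iff_right]

theorem isFirstHit_B (S : Finset Plane) (q p : Plane) :
    IsFirstHit B C cornerA S q p ↔ FirstB (coordB B C) (coordC B C) S q p := by
  simp only [IsFirstHit, FirstB, mem_wedge_B h, sweepTime_B h,
    mul_le_mul_iff_left₀ (neg_pos.2 h), sub_le_sub_iff_left]

theorem isFirstHit_C (S : Finset Plane) (q p : Plane) :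
    IsFirstHit C cornerA B S q p ↔ FirstC (coordB B C) (coordC B C) S q p := by
  simp only [IsFirstHit, FirstC, mem_wedge_C h, sweepTime_C h,
    mul_le_mul_iff_left₀ (neg_pos.2 h), sub_le_sub_iff_left]

/-- Tied points have equal height, so the cross product factors into the height gained from `q` and
a difference of `s`: most clockwise means least `s`. The b- and c-sweeps similarly prefer least `r`
and largest `s`. -/
theorem isNearest_A (S : Finset Plane) (q p : Plane) :
    IsNearest cornerA B C S q p ↔ NearA (coordB B C) (coordC B C) S q p := by
  simp only [IsNearest, NearA, isFirstHit_A h, cross_sub_eq_turn h]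
  refine and_congr_right fun hp => forall_congr' fun x => imp_congr_right fun hx => ?_
  have e1 := hp.2.2.2 x hx.1 hx.2.1 hx.2.2.1
  have e2 := hx.2.2.2 p hp.1 hp.2.1 hp.2.2.1
  obtain ⟨e3, e4⟩ := hp.2.2.1
  have hpos : 0 < coordB B C p + coordC B C p - coordB B C q - coordC B C q := by
    refine lt_of_not_ge fun h' => hp.2.1 (coord_inj h _ _ (by linarith) (by linarith))
  have : turn (coordB B C) (coordC B C) q x p =
      (coordB B C p + coordC B C p - coordB B C q - coordC B C q) *
        (coordB B C x - coordB B C p) := by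
    rw [turn, show coordC B C x = coordB B C p + coordC B C p - coordB B C x by linarith]
    ring
  rw [this, mul_assoc, mul_nonpos_iff_pos_imp_nonpos]
  constructor
  · rintro ⟨h1, -⟩
    have := h1 hpos
    nlinarith
  · exact fun h1 => ⟨fun _ => by nlinarith, fun _ => hpos.le⟩

theorem isNearest_B (S : Finset Plane) (q p : Plane) :
    IsNearest B C cornerA S q p ↔ NearB (coordB B C) (coordC B C) S q p := by
  simp only [IsNearest, NearB, isFirstHit_B h, cross_sub_eq_turn h]
  refine and_congr_right fun hp => forall_congr' fun x => imp_congr_right fun hx => ?_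
  have e1 := hp.2.2.2 x hx.1 hx.2.1 hx.2.2.1
  have e2 := hx.2.2.2 p hp.1 hp.2.1 hp.2.2.1
  obtain ⟨e3, e4⟩ := hp.2.2.1
  have hpos : 0 < coordB B C q - coordB B C p := by
    refine lt_of_not_ge fun h' => hp.2.1 (coord_inj h _ _ (by linarith) (by linarith))
  have : turn (coordB B C) (coordC B C) q x p =
      (coordB B C q - coordB B C p) * (coordC B C x - coordC B C p) := by
    rw [turn, show coordB B C x = coordB B C p by linarith]
    ring
  rw [this, mul_assoc, mul_nonpos_iff_pos_imp_nonpos]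
  constructor
  · rintro ⟨h1, -⟩
    have := h1 hpos
    nlinarith
  · exact fun h1 => ⟨fun _ => by nlinarith, fun _ => hpos.le⟩

theorem isNearest_C (S : Finset Plane) (q p : Plane) :
    IsNearest C cornerA B S q p ↔ NearC (coordB B C) (coordC B C) S q p := by
  simp only [IsNearest, NearC, isFirstHit_C h, cross_sub_eq_turn h]
  refine and_congr_right fun hp => forall_congr' fun x => imp_congr_right fun hx => ?_
  have e1 := hp.2.2.2 x hx.1 hx.2.1 hx.2.2.1
  have e2 := hx.2.2.2 p hp.1 hp.2.1 hp.2.2.1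
  obtain ⟨e3, e4⟩ := hp.2.2.1
  have hpos : 0 < coordC B C q - coordC B C p := by
    refine lt_of_not_ge fun h' => hp.2.1 (coord_inj h _ _ (by linarith) (by linarith))
  have : turn (coordB B C) (coordC B C) q x p =
      (coordC B C q - coordC B C p) * (coordB B C p - coordB B C x) := by
    rw [turn, show coordC B C x = coordC B C p by linarith]
    ring
  rw [this, mul_assoc, mul_nonpos_iff_pos_imp_nonpos]
  constructor
  · rintro ⟨h1, -⟩
    have := h1 hpos
    nlinarith
  · exact fun h1 => ⟨fun _ => by nlinarith, fun _ => hpos.le⟩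

theorem threeSweep_adj (S : Finset Plane) (u v : Plane) :
    (threeSweep cornerA B C S).Adj u v ↔ SweepAdj (coordB B C) (coordC B C) S u v := by
  simp only [threeSweep, SweepsTo, SweepAdj, isNearest_A h, isNearest_B h, isNearest_C h]

theorem mem_interior_wedge_A (q p : Plane) : p ∈ interior (wedge cornerA B C q) ↔
    coordB B C q < coordB B C p ∧ coordC B C q < coordC B C p := by
  have hcB : Continuous (coordB B C) := by unfold coordB cross; fun_prop
  have hcC : Continuous (coordC B C) := by unfold coordC cross; fun_prop
  constructor
  · intro hp
    -- Moving back along `B + C` lowers both coordinates equally; staying in the wedge for some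
    -- positive `ε` makes both inequalities strict.
    have hc : Continuous fun ε : ℝ => p - ε • (B + C) := by fun_prop
    have hev : ∀ᶠ ε in nhds (0 : ℝ), p - ε • (B + C) ∈ wedge cornerA B C q := by
      refine hc.continuousAt.eventually_mem ?_
      simpa using mem_interior_iff_mem_nhds.1 hp
    obtain ⟨δ, hδ, hball⟩ := Metric.eventually_nhds_iff.1 hev
    have hm := (mem_wedge_A h _ _).1 (@hball (δ / 2) (by
      rw [Real.dist_eq, sub_zero, abs_of_pos (by linarith)]; linarith))
    have e1 : coordB B C (p - (δ / 2) • (B + C)) = coordB B C p - δ / 2 := by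
      have h' : B 0 * C 1 - B 1 * C 0 ≠ 0 := h.ne
      simp only [coordB, cross, PiLp.sub_apply, PiLp.smul_apply, PiLp.add_apply, smul_eq_mul]
      rw [div_eq_iff h', sub_mul (_ / _), div_mul_cancel₀ _ h']
      ring
    have e2 : coordC B C (p - (δ / 2) • (B + C)) = coordC B C p - δ / 2 := by
      have h' : B 0 * C 1 - B 1 * C 0 ≠ 0 := h.ne
      simp only [coordC, cross, PiLp.sub_apply, PiLp.smul_apply, PiLp.add_apply, smul_eq_mul]
      rw [div_eq_iff h', sub_mul (_ / _), div_mul_cancel₀ _ h']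
      ring
    rw [InA, e1, e2] at hm
    exact ⟨by linarith [hm.1], by linarith [hm.2]⟩
  · intro hp
    refine mem_interior.2 ⟨{x | coordB B C q < coordB B C x ∧ coordC B C q < coordC B C x},
      fun x hx => (mem_wedge_A h _ _).2 ⟨hx.1.le, hx.2.le⟩, ?_, hp⟩
    exact (isOpen_lt continuous_const hcB).inter (isOpen_lt continuous_const hcC)

end Coordinates

/-! ### The layers -/

theorem cross_unit (a b : ℝ) : cross (unit a) (unit b) = Real.sin (b - a) := by
  simp [cross, unit, Real.sin_sub]
  ring

theorem cross_corners {k : ℕ} (hk : 5 ≤ k) (i : Fin k) :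
    cross (cornerB k i) (cornerC k i) < 0 := by
  have hk' : (5 : ℝ) ≤ k := by exact_mod_cast hk
  have hp := Real.pi_pos
  rw [cornerB, cornerC, cross_unit, show Real.pi / 2 - Real.pi / k - 2 * Real.pi * (i : ℕ) / k -
    (Real.pi / 2 + Real.pi / k - 2 * Real.pi * (i : ℕ) / k) = -(2 * (Real.pi / k)) by ring,
    Real.sin_neg, neg_lt_zero]
  refine Real.sin_pos_of_pos_of_lt_pi (by positivity) ?_
  have : Real.pi / k ≤ Real.pi / 5 := by gcongr
  linarith

/-- The coordinate along `AB` in the `i`-th layer. -/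
noncomputable def layerB (k : ℕ) (i : Fin k) : Plane → ℝ := coordB (cornerB k i) (cornerC k i)

/-- The coordinate along `AC` in the `i`-th layer. -/
noncomputable def layerC (k : ℕ) (i : Fin k) : Plane → ℝ := coordC (cornerB k i) (cornerC k i)

section Layer

variable {k : ℕ} (hk : 5 ≤ k) (i : Fin k)
include hk

theorem layer_inj (p q : Plane) (h1 : layerB k i p = layerB k i q)
    (h2 : layerC k i p = layerC k i q) : p = q := coord_inj (cross_corners hk i) p q h1 h2

theorem mem_wedgeA_iff (q p : Plane) :
    p ∈ wedgeA k i q ↔ InA (layerB k i) (layerC k i) q p := mem_wedge_A (cross_corners hk i) q p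

theorem layer_adj_iff (S : Finset Plane) (u v : Plane) :
    (layer k i S).Adj u v ↔ SweepAdj (layerB k i) (layerC k i) S u v :=
  threeSweep_adj (cross_corners hk i) S u v

theorem stepA_iff (S : Finset Plane) (t u w : Plane) :
    StepA k i S t u w ↔ Step (layerB k i) (layerC k i) S t u w := by
  have h := cross_corners hk i
  have e : ∀ x : ℝ, x * cross (cornerB k i) (cornerC k i) < 0 ↔ 0 < x := fun x =>
    ⟨fun hx => by nlinarith, fun hx => mul_neg_of_pos_of_neg hx h⟩
  have e' : ∀ x : ℝ, 0 < x * cross (cornerB k i) (cornerC k i) ↔ x < 0 := fun x =>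
    ⟨fun hx => by nlinarith, fun hx => mul_pos_of_neg_of_neg hx h⟩
  simp only [StepA, wedgeA, wedgeB, wedgeC, LeftStep, RightStep, LeftCandidate, RightCandidate,
    layer, mem_interior_wedge_A h, isNearest_A h, mem_wedge_B h, mem_wedge_C h, threeSweep_adj h,
    cross_sub_eq_turn h, e, e']
  rfl

end Layer

/-! ### Cones and angle-monotone paths -/

theorem inner_plane (u v : Plane) : inner ℝ u v = u 0 * v 0 + u 1 * v 1 := by
  simp [PiLp.inner_apply, Fin.sum_univ_two]
  ring

theorem norm_unit (a : ℝ) : ‖unit a‖ = 1 := by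
  rw [EuclideanSpace.norm_eq, Fin.sum_univ_two]
  simp [unit]

theorem inner_unit (a b : ℝ) : inner ℝ (unit a) (unit b) = Real.cos (a - b) := by
  rw [inner_plane]
  simp [unit, Real.cos_sub]

theorem unit_add_int_mul_two_pi (a : ℝ) (n : ℤ) : unit (a + n * (2 * Real.pi)) = unit a := by
  simp [unit, Real.cos_add_int_mul_two_pi, Real.sin_add_int_mul_two_pi]

theorem unit_mem_cone {φ γ a : ℝ} (h : Real.cos (γ / 2) ≤ Real.cos (φ - a)) :
    unit a ∈ cone φ γ := by
  simpa [cone, norm_unit, inner_unit] using h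

theorem smul_add_smul_mem_cone {φ γ : ℝ} (hγ : 0 ≤ Real.cos (γ / 2)) {u v : Plane}
    (hu : u ∈ cone φ γ) (hv : v ∈ cone φ γ) {a b : ℝ} (ha : 0 ≤ a) (hb : 0 ≤ b) :
    a • u + b • v ∈ cone φ γ := by
  simp only [cone, Set.mem_ofPred_eq] at hu hv ⊢
  rw [inner_add_right, inner_smul_right, inner_smul_right]
  have h1 : ‖a • u + b • v‖ ≤ a * ‖u‖ + b * ‖v‖ := by
    refine (norm_add_le _ _).trans_eq ?_
    rw [norm_smul, norm_smul, Real.norm_of_nonneg ha, Real.norm_of_nonneg hb]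
  nlinarith [mul_le_mul_of_nonneg_right h1 hγ, mul_le_mul_of_nonneg_left hu ha,
    mul_le_mul_of_nonneg_left hv hb]

/-- Each edge projects on the bisector to at least its length times `cos (γ / 2)`, and the
projections telescope. -/
theorem pathLength_le_of_mem_cone {φ γ : ℝ} (hγ : 0 < Real.cos (γ / 2)) {x : ℕ → Plane} {m : ℕ}
    (h : ∀ j < m, x (j + 1) - x j ∈ cone φ γ) :
    pathLength x m ≤ 1 / Real.cos (γ / 2) * dist (x 0) (x m) := by
  rw [one_div, inv_mul_eq_div, le_div_iff₀ hγ]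
  have h1 : pathLength x m * Real.cos (γ / 2) ≤ inner ℝ (unit φ) (x m - x 0) := by
    rw [← Finset.sum_range_sub, inner_sum, pathLength, Finset.sum_mul]
    refine Finset.sum_le_sum fun j hj => ?_
    have := h j (Finset.mem_range.1 hj)
    rwa [dist_comm, dist_eq_norm]
  have h2 := real_inner_le_norm (unit φ) (x m - x 0)
  rw [norm_unit, one_mul, ← dist_eq_norm, dist_comm] at h2
  exact h1.trans h2

theorem exists_fin_eq_add_mul {k : ℕ} (hk : 0 < k) (n : ℤ) :
    ∃ i : Fin k, ∃ m : ℤ, (n : ℝ) = (i : ℕ) + k * m := by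
  have hk' : (0 : ℤ) < k := by exact_mod_cast hk
  have h0 := Int.emod_nonneg n hk'.ne'
  have h1 := Int.emod_lt_of_pos n hk'
  refine ⟨⟨(n % k).toNat, by omega⟩, n / k, ?_⟩
  have h2 : (n : ℤ) = ((n % k).toNat : ℤ) + k * (n / k) := by
    rw [Int.toNat_of_nonneg h0, Int.emod_add_mul_ediv]
  exact_mod_cast congrArg (Int.cast : ℤ → ℝ) h2

/-- The direction of the bisector at `A` in the `i`-th layer. -/
noncomputable def layerAxis (k : ℕ) (i : Fin k) : ℝ :=
  Real.pi / 2 - 2 * Real.pi * (i : ℕ) / k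

theorem cornerB_eq (k : ℕ) (i : Fin k) : cornerB k i = unit (layerAxis k i + Real.pi / k) := by
  rw [cornerB, layerAxis]
  ring_nf

theorem cornerC_eq (k : ℕ) (i : Fin k) : cornerC k i = unit (layerAxis k i - Real.pi / k) := by
  rw [cornerC, layerAxis]
  ring_nf

theorem unit_sub_unit (θ α : ℝ) :
    unit (θ + α) - unit (θ - α) = (2 * Real.sin α) • unit (θ + Real.pi / 2) := by
  apply plane_ext <;> simp [unit, Real.cos_add, Real.cos_sub, Real.sin_add, Real.sin_sub] <;> ring

theorem exists_polar (v : Plane) : ∃ ρ φ : ℝ, 0 ≤ ρ ∧ v = ρ • unit φ := by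
  refine ⟨‖(⟨v 0, v 1⟩ : ℂ)‖, Complex.arg ⟨v 0, v 1⟩, norm_nonneg _, ?_⟩
  apply plane_ext
  · simp [unit, Complex.norm_mul_cos_arg]
  · simp [unit, Complex.norm_mul_sin_arg]

theorem pi_div_bounds {k : ℕ} (hk : 5 ≤ k) : 0 < Real.pi / k ∧ Real.pi / k ≤ Real.pi / 5 := by
  have hk' : (5 : ℝ) ≤ k := by exact_mod_cast hk
  have hp := Real.pi_pos
  exact ⟨by positivity, by gcongr⟩

theorem exists_mem_wedgeA {k : ℕ} (hk : 5 ≤ k) (q t : Plane) : ∃ i : Fin k, t ∈ wedgeA k i q := by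
  obtain ⟨hα, hα'⟩ := pi_div_bounds hk
  have hk0 : (0 : ℝ) < k := by exact_mod_cast (by omega : 0 < k)
  have hp := Real.pi_pos
  obtain ⟨ρ, φ, hρ, hv⟩ := exists_polar (t - q)
  -- The clockwise angle from the vertical in units of `2π/k`; rounding selects the layer and leaves
  -- an error of at most `π/k`, half the angle of the wedge.
  set x : ℝ := (Real.pi / 2 - φ) * k / (2 * Real.pi) with hx
  obtain ⟨i, m, him⟩ := exists_fin_eq_add_mul (by omega : 0 < k) (round x)
  have hround := abs_le.1 (abs_sub_round x)
  set δ : ℝ := φ - (layerAxis k i - m * (2 * Real.pi)) with hδ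
  have hδx : δ = -(2 * (Real.pi / k)) * (x - round x) := by
    rw [hδ, him, hx, layerAxis]
    field_simp
    ring
  have e0 : unit φ = unit (layerAxis k i + δ) := by
    rw [hδ, ← unit_add_int_mul_two_pi φ m]
    ring_nf
  refine ⟨i, ?_⟩
  rw [wedgeA, mem_wedge_iff (by simpa [cornerA] using cross_corners hk i), hv, e0, cornerB_eq,
    cornerC_eq]
  have c1 : ∀ a b : Plane, cross (ρ • a) b = ρ * cross a b := by
    intro a b
    simp [cross]
    ring
  have c2 : ∀ a b : Plane, cross a (ρ • b) = ρ * cross a b := by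
    intro a b
    simp [cross]
    ring
  simp only [cornerA, sub_zero, c1, c2, cross_unit]
  have hb1 : δ ≤ Real.pi / k := by rw [hδx]; nlinarith
  have hb2 : -(Real.pi / k) ≤ δ := by rw [hδx]; nlinarith
  constructor
  · refine mul_nonpos_of_nonneg_of_nonpos hρ (Real.sin_nonpos_of_nonpos_of_neg_pi_le ?_ ?_)
    · linarith
    · linarith
  · refine mul_nonpos_of_nonneg_of_nonpos hρ (Real.sin_nonpos_of_nonpos_of_neg_pi_le ?_ ?_)
    · linarith
    · linarith

section Edges

variable {k : ℕ} (hk : 5 ≤ k) (i : Fin k)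
include hk

theorem cos_width_pos : 0 < Real.cos ((Real.pi / 2 + Real.pi / k) / 2) := by
  obtain ⟨hα, hα'⟩ := pi_div_bounds hk
  have hp := Real.pi_pos
  exact Real.cos_pos_of_mem_Ioo ⟨by linarith, by linarith⟩

theorem sin_angle_nonneg : 0 ≤ 2 * Real.sin (Real.pi / k) := by
  obtain ⟨hα, hα'⟩ := pi_div_bounds hk
  have hp := Real.pi_pos
  have := Real.sin_nonneg_of_nonneg_of_le_pi hα.le (by linarith)
  linarith

/-- The edge is a nonnegative combination of `B - C`, of length `2 sin (π/k)` and perpendicular to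
the axis, and `C`. These two directions bound the cone. -/
theorem LeftEdge.mem_cone {u w : Plane} (h : LeftEdge (layerB k i) (layerC k i) u w) :
    w - u ∈ cone (layerAxis k i + (Real.pi / 4 - Real.pi / k / 2))
      (Real.pi / 2 + Real.pi / k) := by
  have e : w - u =
      ((layerB k i w - layerB k i u) * (2 * Real.sin (Real.pi / k))) •
        unit (layerAxis k i + Real.pi / 2) +
      (layerB k i w + layerC k i w - (layerB k i u + layerC k i u)) • cornerC k i := by
    rw [mul_smul, ← unit_sub_unit, ← cornerB_eq, ← cornerC_eq,
      sub_eq_coord (cross_corners hk i) w u]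
    simp only [layerB, layerC]
    module
  rw [e]
  refine smul_add_smul_mem_cone (cos_width_pos hk).le (unit_mem_cone ?_) ?_
    (mul_nonneg (sub_nonneg.2 h.1) (sin_angle_nonneg hk)) (sub_nonneg.2 h.2)
  · rw [← Real.cos_neg]
    exact le_of_eq (congrArg Real.cos (by ring))
  · rw [cornerC_eq]
    exact unit_mem_cone (le_of_eq (congrArg Real.cos (by ring)))

theorem RightEdge.mem_cone {u w : Plane} (h : RightEdge (layerB k i) (layerC k i) u w) :
    w - u ∈ cone (layerAxis k i - (Real.pi / 4 - Real.pi / k / 2))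
      (Real.pi / 2 + Real.pi / k) := by
  have e : w - u =
      ((layerC k i w - layerC k i u) * (2 * Real.sin (Real.pi / k))) •
        unit (layerAxis k i - Real.pi / 2) +
      (layerB k i w + layerC k i w - (layerB k i u + layerC k i u)) • cornerB k i := by
    have hn : unit (layerAxis k i - Real.pi / 2) = (-1 : ℝ) • unit (layerAxis k i + Real.pi / 2) := by
      apply plane_ext <;> simp [unit, Real.cos_add, Real.cos_sub, Real.sin_add, Real.sin_sub]
    rw [hn, smul_comm _ (-1 : ℝ), mul_smul, ← unit_sub_unit, ← cornerB_eq, ← cornerC_eq,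
      sub_eq_coord (cross_corners hk i) w u]
    simp only [layerB, layerC]
    module
  rw [e]
  refine smul_add_smul_mem_cone (cos_width_pos hk).le (unit_mem_cone ?_) ?_
    (mul_nonneg (sub_nonneg.2 h.1) (sin_angle_nonneg hk)) (sub_nonneg.2 h.2)
  · exact le_of_eq (congrArg Real.cos (by ring))
  · rw [cornerB_eq]
    refine unit_mem_cone ?_
    rw [← Real.cos_neg]
    exact le_of_eq (congrArg Real.cos (by ring))

end Edges

/-! ### Routers -/

theorem Router.route_eq_iterate {k : ℕ} (R : Router k) (r : ℕ) (G : SimpleGraph Plane)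
    (i : Fin k) (q t : Plane) (n : ℕ) :
    R.route r G i q t n = (fun u => R.next i t u (localView G r u))^[n] q := by
  induction n with
  | zero => rfl
  | succ n ih => rw [Function.iterate_succ_apply', ← ih, Router.route]

theorem layer_le_layeredSweep (k : ℕ) (i : Fin k) (S : Finset Plane) :
    layer k i S ≤ layeredSweep k S := le_iSup (fun i => layer k i S) i

theorem SweepAdj.mem_right {V : Type*} {s r : V → ℝ} {S : Finset V} {u v : V}
    (h : SweepAdj s r S u v) : v ∈ S := by
  rcases h.2 with ⟨-, h | h | h⟩ | ⟨h, -⟩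
  exacts [h.1.1, h.1.1, h.1.1, h]

theorem layeredSweep_mem_right {k : ℕ} (hk : 5 ≤ k) {S : Finset Plane} {u v : Plane}
    (h : (layeredSweep k S).Adj u v) : v ∈ S := by
  obtain ⟨i, hi⟩ := SimpleGraph.iSup_adj.1 h
  exact ((layer_adj_iff hk i S u v).1 hi).mem_right

/-- If the steps of the algorithm are determined by the `r`-neighbourhoods, then the algorithm is
carried out by an `r`-local router. -/
theorem exists_router {k : ℕ} (hk : 5 ≤ k) (r : ℕ) (P : Finset Plane → Prop)
    (hlocal : ∀ (i : Fin k) (t u w w' : Plane) (S S' : Finset Plane), P S → P S' → u ≠ t →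
      State (layerB k i) (layerC k i) S t u → State (layerB k i) (layerC k i) S' t u →
      localView (layeredSweep k S) r u = localView (layeredSweep k S') r u →
      StepA k i S t u w → StepA k i S' t u w' → w = w') :
    ∃ R : Router k, R.Works r P (Real.pi / 2 + Real.pi / k)
      (1 / Real.cos (Real.pi / 4 + Real.pi / k / 2)) := by
  choose start hstart using exists_mem_wedgeA hk
  -- The router cannot know `S`, so it takes a step that is correct for some point set with the
  -- observed view; `hlocal` makes it correct for `S` too.
  refine ⟨⟨start, fun i t u G => Classical.epsilon fun w => ∃ S, P S ∧
    State (layerB k i) (layerC k i) S t u ∧ localView (layeredSweep k S) r u = G ∧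
    StepA k i S t u w⟩, hstart, fun S hS q hq t ht i hi => ?_⟩
  set R : Router k := ⟨start, fun i t u G => Classical.epsilon fun w => ∃ S, P S ∧
    State (layerB k i) (layerC k i) S t u ∧ localView (layeredSweep k S) r u = G ∧
    StepA k i S t u w⟩ with hR
  have hinj := layer_inj hk i
  have hnext : ∀ u, State (layerB k i) (layerC k i) S t u → u ≠ t →
      StepA k i S t u (R.next i t u (localView (layeredSweep k S) r u)) := by
    intro u hu hne
    obtain ⟨w, hw⟩ := hu.exists_step hinj hne
    rw [← stepA_iff hk] at hw
    obtain ⟨S', hS', hu', hview, hstep⟩ := Classical.epsilon_spec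
      (p := fun w => ∃ S', P S' ∧ State (layerB k i) (layerC k i) S' t u ∧
        localView (layeredSweep k S') r u = localView (layeredSweep k S) r u ∧
        StepA k i S' t u w) ⟨w, S, hS, hu, rfl, hw⟩
    have := hlocal i t u _ _ S' S hS' hS hne hu' hu hview hstep hw
    rw [hR]
    rw [← this] at hw
    exact hw
  have hq' : State (layerB k i) (layerC k i) S t q :=
    state_of_inA hq ht ((mem_wedgeA_iff hk i q t).1 hi)
  have hroute := R.route_eq_iterate r (layeredSweep k S) i q t
  have hwidth : Real.pi / 4 + Real.pi / k / 2 = (Real.pi / 2 + Real.pi / k) / 2 := by ring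
  have finish : ∀ {E : Plane → Plane → Prop} {φ : ℝ},
      (∀ u w, E u w → w - u ∈ cone φ (Real.pi / 2 + Real.pi / k)) →
      Reaches (fun u => R.next i t u (localView (layeredSweep k S) r u)) t
        (State (layerB k i) (layerC k i) S t) E q →
      ∃ m : ℕ,
        R.route r (layeredSweep k S) i q t m = t ∧
        (∀ j < m,
          R.route r (layeredSweep k S) i q t j ≠ t ∧
          (layeredSweep k S).Adj (R.route r (layeredSweep k S) i q t j)
            (R.route r (layeredSweep k S) i q t (j + 1)) ∧
          StepA k i S t (R.route r (layeredSweep k S) i q t j)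
            (R.route r (layeredSweep k S) i q t (j + 1))) ∧
        AngleMonotone (Real.pi / 2 + Real.pi / k) (R.route r (layeredSweep k S) i q t) m ∧
        pathLength (R.route r (layeredSweep k S) i q t) m ≤
          1 / Real.cos (Real.pi / 4 + Real.pi / k / 2) * dist q t := by
    rintro E φ hE ⟨m, hm, hj⟩
    simp only [← hroute] at hm hj
    have hcone : ∀ j < m, R.route r (layeredSweep k S) i q t (j + 1) -
        R.route r (layeredSweep k S) i q t j ∈ cone φ (Real.pi / 2 + Real.pi / k) :=
      fun j hjm => hE _ _ (hj j hjm).2.2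
    refine ⟨m, hm, fun j hjm => ?_, ⟨φ, hcone⟩, ?_⟩
    · obtain ⟨h1, h2, -⟩ := hj j hjm
      have h3 := hnext _ h2 h1
      exact ⟨h1, layer_le_layeredSweep k i S ((layer_adj_iff hk i S _ _).2
        (h2.sweepAdj hinj h1 ((stepA_iff hk i S t _ _).1 h3))), h3⟩
    · have := pathLength_le_of_mem_cone (cos_width_pos hk) hcone
      rwa [hm, ← hwidth] at this
  rcases hq'.reaches hinj (fun u hu hne => (stepA_iff hk i S t _ _).1 (hnext u hu hne)) with h | h
  · exact finish (fun u w => LeftEdge.mem_cone hk i) h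
  · exact finish (fun u w => RightEdge.mem_cone hk i) h

theorem localView_adj_iff {G : SimpleGraph Plane} {r : ℕ} (hr : 0 < r) (u v : Plane) :
    (localView G r u).Adj u v ↔ G.Adj u v :=
  ⟨fun h => h.1, fun h => ⟨h, Or.inl ⟨SimpleGraph.Walk.nil, hr⟩⟩⟩

theorem localView_adj_iff_of_adj {G : SimpleGraph Plane} {r : ℕ} (hr : 1 < r) {u v : Plane}
    (h : G.Adj u v) (x : Plane) : (localView G r u).Adj v x ↔ G.Adj v x :=
  ⟨fun h => h.1, fun h' => ⟨h', Or.inl ⟨h.toWalk, by simpa using hr⟩⟩⟩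

theorem exists_router_two {k : ℕ} (hk : 5 ≤ k) :
    ∃ R : Router k, R.Works 2 (fun _ => True) (Real.pi / 2 + Real.pi / k)
      (1 / Real.cos (Real.pi / 4 + Real.pi / k / 2)) := by
  refine exists_router hk 2 _ fun i t u w w' S S' _ _ _ hu hu' hview hw hw' => ?_
  have hN : ∀ v, (layeredSweep k S).Adj u v ↔ (layeredSweep k S').Adj u v := fun v => by
    rw [← localView_adj_iff two_pos, hview, localView_adj_iff two_pos]
  exact Step.unique_of_view_two (layer_inj hk i)
    (fun a b h => layer_le_layeredSweep k i S ((layer_adj_iff hk i S a b).2 h))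
    (fun a b => layeredSweep_mem_right hk)
    (fun a b h => layer_le_layeredSweep k i S' ((layer_adj_iff hk i S' a b).2 h))
    (fun a b => layeredSweep_mem_right hk) hu.mem hu'.mem hN
    (fun v hv x => by
      rw [← localView_adj_iff_of_adj one_lt_two hv, hview,
        localView_adj_iff_of_adj one_lt_two ((hN v).1 hv)])
    ((stepA_iff hk i S t u w).1 hw) ((stepA_iff hk i S' t u w').1 hw')

/-! ### Six cones -/

/-- `p` is a closest point of `S` in the cone of `q` of angle `π / 3` with axis `φ`. -/
def ConeClosest (φ : ℝ) (S : Finset Plane) (q p : Plane) : Prop :=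
  p ∈ S ∧ p ≠ q ∧ p - q ∈ cone φ (Real.pi / 3) ∧
    ∀ p' ∈ S, p' ≠ q → p' - q ∈ cone φ (Real.pi / 3) →
      inner ℝ (unit φ) (p - q) ≤ inner ℝ (unit φ) (p' - q)

/-- `p` is the neighbour selected by `q` in the cone of angle `π / 3` with axis `φ`. -/
def ConeNearest (φ : ℝ) (S : Finset Plane) (q p : Plane) : Prop :=
  ConeClosest φ S q p ∧ ∀ p', ConeClosest φ S q p' → cross (p' - q) (p - q) ≤ 0

theorem coneNearest_congr {φ ψ : ℝ} (h : unit φ = unit ψ) (S : Finset Plane) (q p : Plane) :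
    ConeNearest φ S q p ↔ ConeNearest ψ S q p := by
  simp only [ConeNearest, ConeClosest, cone, h]

theorem isThetaNearest_iff (j : Fin 6) (S : Finset Plane) (q p : Plane) :
    IsThetaNearest 6 j S q p ↔ ConeNearest (Real.pi / 2 + (j : ℕ) * (Real.pi / 3)) S q p := by
  have h1 : 2 * Real.pi / ((6 : ℕ) : ℝ) = Real.pi / 3 := by push_cast; ring
  have h2 : thetaAxis 6 j = Real.pi / 2 + (j : ℕ) * (Real.pi / 3) := by
    rw [thetaAxis]
    push_cast
    ring
  simp only [IsThetaNearest, IsThetaClosest, ConeNearest, ConeClosest, h1, h2]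

/-- With `x` along the axis and `y` across it, both sides say `√3 |y| ≤ x`. -/
theorem mem_cone_pi_div_three (φ : ℝ) (v : Plane) : v ∈ cone φ (Real.pi / 3) ↔
    cross v (unit (φ - Real.pi / 6)) ≤ 0 ∧ cross (unit (φ + Real.pi / 6)) v ≤ 0 := by
  have hcs := Real.sin_sq_add_cos_sq φ
  have h3 : Real.sqrt 3 ^ 2 = 3 := Real.sq_sqrt (by norm_num)
  have h3' : 0 < Real.sqrt 3 := by positivity
  set x : ℝ := inner ℝ (unit φ) v with hx
  set y : ℝ := cross (unit φ) v with hy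
  have hx' : x = Real.cos φ * v 0 + Real.sin φ * v 1 := by rw [hx, inner_plane]; simp [unit]
  have hy' : y = Real.cos φ * v 1 - Real.sin φ * v 0 := by rw [hy, cross]; simp [unit]
  have hn : ‖v‖ ^ 2 = x ^ 2 + y ^ 2 := by
    rw [EuclideanSpace.norm_sq_eq, Fin.sum_univ_two, hx', hy', Real.norm_eq_abs, Real.norm_eq_abs,
      sq_abs, sq_abs]
    linear_combination -(v 0 ^ 2 + v 1 ^ 2) * hcs
  have e1 : cross v (unit (φ - Real.pi / 6)) = -(x + Real.sqrt 3 * y) / 2 := by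
    rw [hx', hy', cross]
    simp [unit, Real.cos_sub, Real.sin_sub, Real.cos_pi_div_six, Real.sin_pi_div_six]
    ring
  have e2 : cross (unit (φ + Real.pi / 6)) v = -(x - Real.sqrt 3 * y) / 2 := by
    rw [hx', hy', cross]
    simp [unit, Real.cos_add, Real.sin_add, Real.cos_pi_div_six, Real.sin_pi_div_six]
    ring
  have e3 : v ∈ cone φ (Real.pi / 3) ↔ ‖v‖ * (Real.sqrt 3 / 2) ≤ x := by
    rw [cone, Set.mem_ofPred_eq, show Real.pi / 3 / 2 = Real.pi / 6 by ring, Real.cos_pi_div_six]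
  have hsq : (‖v‖ * (Real.sqrt 3 / 2)) ^ 2 = 3 / 4 * (x ^ 2 + y ^ 2) := by
    rw [mul_pow, hn, div_pow, h3]
    ring
  rw [e3, e1, e2]
  constructor
  · intro h
    have h0 : 0 ≤ ‖v‖ * (Real.sqrt 3 / 2) := by positivity
    have h4 := pow_le_pow_left₀ h0 h 2
    rw [hsq] at h4
    have h5 := abs_le.1 (abs_le_of_sq_le_sq (a := Real.sqrt 3 * y) (b := x)
      (by rw [mul_pow, h3]; linarith) (h0.trans h))
    exact ⟨by linarith [h5.1], by linarith [h5.2]⟩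
  · rintro ⟨h1, h2⟩
    have h5 := sq_le_sq' (a := Real.sqrt 3 * y) (b := x) (by linarith) (by linarith)
    rw [mul_pow, h3] at h5
    refine (le_abs_self _).trans (abs_le_of_sq_le_sq ?_ (by linarith))
    rw [hsq]
    linarith

section Equilateral

variable {φ : ℝ} {X Y Z : Plane} (hY : Y - X = unit (φ + Real.pi / 6))
  (hZ : Z - X = unit (φ - Real.pi / 6))
include hY hZ

theorem mem_wedge_iff_mem_cone (q p : Plane) :
    p ∈ wedge X Y Z q ↔ p - q ∈ cone φ (Real.pi / 3) := by
  rw [mem_wedge_iff, hY, hZ, mem_cone_pi_div_three]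
  rw [hY, hZ, cross_unit, show φ - Real.pi / 6 - (φ + Real.pi / 6) = -(Real.pi / 3) by ring,
    Real.sin_neg, Real.sin_pi_div_three, neg_lt_zero]
  positivity

/-- The side `YZ` is a unit vector perpendicular to the axis, so the cross product with it is the
projection on the axis. -/
theorem sweepTime_eq_inner (q p : Plane) : sweepTime Y Z q p = inner ℝ (unit φ) (p - q) := by
  have h : Z - Y = unit (φ - Real.pi / 2) := by
    have : Z - Y = (Z - X) - (Y - X) := by abel
    rw [this, hY, hZ]
    apply plane_ext <;>
      simp [unit, Real.cos_add, Real.cos_sub, Real.sin_add, Real.sin_sub] <;> ring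
  rw [sweepTime, h, inner_plane, cross]
  simp [unit, Real.cos_sub, Real.sin_sub]
  ring

theorem isNearest_iff_coneNearest (S : Finset Plane) (q p : Plane) :
    IsNearest X Y Z S q p ↔ ConeNearest φ S q p := by
  simp only [IsNearest, ConeNearest, IsFirstHit, ConeClosest, mem_wedge_iff_mem_cone hY hZ,
    sweepTime_eq_inner hY hZ]

/-- The reflected cone of a wedge of an equilateral triangle. -/
theorem ConeNearest.reflect {S : Finset Plane} {q p : Plane}
    (h : ConeNearest (φ + Real.pi) S q p) :
    q ∈ wedge X Y Z p ∧
      ∀ x ∈ S, x ≠ q → q ∈ wedge X Y Z x → sweepTime Y Z p q ≤ sweepTime Y Z x q := by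
  have hu : unit (φ + Real.pi) = -unit φ := by
    apply plane_ext <;> simp [unit, Real.cos_add_pi, Real.sin_add_pi]
  have hc : ∀ x : Plane, x - q ∈ cone (φ + Real.pi) (Real.pi / 3) ↔ q ∈ wedge X Y Z x := by
    intro x
    rw [mem_wedge_iff_mem_cone hY hZ, cone, cone, Set.mem_ofPred_eq, Set.mem_ofPred_eq, hu,
      inner_neg_left, ← inner_neg_right, neg_sub, norm_sub_rev]
  refine ⟨(hc p).1 h.1.2.2.1, fun x hx hxq hqx => ?_⟩
  have := h.1.2.2.2 x hx hxq ((hc x).2 hqx)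
  rw [sweepTime_eq_inner hY hZ, sweepTime_eq_inner hY hZ]
  rwa [hu, inner_neg_left, ← inner_neg_right, neg_sub, inner_neg_left, ← inner_neg_right,
    neg_sub] at this

end Equilateral

section Six

variable (i : Fin 6)

theorem sideA_B : cornerB 6 i - cornerA = unit (layerAxis 6 i + Real.pi / 6) := by
  rw [cornerB_eq, cornerA, sub_zero]
  norm_num

theorem sideA_C : cornerC 6 i - cornerA = unit (layerAxis 6 i - Real.pi / 6) := by
  rw [cornerC_eq, cornerA, sub_zero]
  norm_num

theorem sideB_C :
    cornerC 6 i - cornerB 6 i = unit (layerAxis 6 i - 2 * (Real.pi / 3) + Real.pi / 6) := by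
  have h := unit_sub_unit (layerAxis 6 i) (Real.pi / 6)
  rw [Real.sin_pi_div_six, mul_one_div_cancel two_ne_zero, one_smul] at h
  have e : cornerC 6 i - cornerB 6 i = -(unit (layerAxis 6 i + Real.pi / 6) -
      unit (layerAxis 6 i - Real.pi / 6)) := by
    rw [← sideA_B, ← sideA_C]
    abel
  rw [e, h, show layerAxis 6 i - 2 * (Real.pi / 3) + Real.pi / 6 =
    layerAxis 6 i - Real.pi / 2 by ring]
  apply plane_ext <;> simp [unit, Real.cos_add, Real.cos_sub, Real.sin_add, Real.sin_sub]

theorem unit_sub_pi (a : ℝ) : unit (a - Real.pi) = -unit a := by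
  apply plane_ext <;> simp [unit, Real.cos_sub_pi, Real.sin_sub_pi]

theorem unit_add_pi (a : ℝ) : unit (a + Real.pi) = -unit a := by
  apply plane_ext <;> simp [unit, Real.cos_add_pi, Real.sin_add_pi]

theorem sideB_A :
    cornerA - cornerB 6 i = unit (layerAxis 6 i - 2 * (Real.pi / 3) - Real.pi / 6) := by
  rw [← neg_sub, sideA_B, ← unit_sub_pi]
  congr 1
  ring

theorem sideC_A :
    cornerA - cornerC 6 i = unit (layerAxis 6 i + 2 * (Real.pi / 3) + Real.pi / 6) := by
  rw [← neg_sub, sideA_C, ← unit_add_pi]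
  congr 1
  ring

theorem sideC_B :
    cornerB 6 i - cornerC 6 i = unit (layerAxis 6 i + 2 * (Real.pi / 3) - Real.pi / 6) := by
  rw [← neg_sub, sideB_C, ← unit_add_pi]
  congr 1
  ring

theorem nearA_iff (S : Finset Plane) (q p : Plane) :
    NearA (layerB 6 i) (layerC 6 i) S q p ↔ ConeNearest (layerAxis 6 i) S q p :=
  (isNearest_A (cross_corners (by norm_num) i) S q p).symm.trans
    (isNearest_iff_coneNearest (sideA_B i) (sideA_C i) S q p)

theorem nearB_iff (S : Finset Plane) (q p : Plane) :
    NearB (layerB 6 i) (layerC 6 i) S q p ↔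
      ConeNearest (layerAxis 6 i - 2 * (Real.pi / 3)) S q p :=
  (isNearest_B (cross_corners (by norm_num) i) S q p).symm.trans
    (isNearest_iff_coneNearest (sideB_C i) (sideB_A i) S q p)

theorem nearC_iff (S : Finset Plane) (q p : Plane) :
    NearC (layerB 6 i) (layerC 6 i) S q p ↔
      ConeNearest (layerAxis 6 i + 2 * (Real.pi / 3)) S q p :=
  (isNearest_C (cross_corners (by norm_num) i) S q p).symm.trans
    (isNearest_iff_coneNearest (sideC_A i) (sideC_B i) S q p)

theorem layerAxis_six : layerAxis 6 i = Real.pi / 2 - (i : ℕ) * (Real.pi / 3) := by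
  rw [layerAxis]
  push_cast
  ring

theorem layer_six_adj (S : Finset Plane) (u v : Plane) : (layer 6 i S).Adj u v ↔ u ≠ v ∧
    ((u ∈ S ∧ (ConeNearest (layerAxis 6 i) S u v ∨
        ConeNearest (layerAxis 6 i - 2 * (Real.pi / 3)) S u v ∨
        ConeNearest (layerAxis 6 i + 2 * (Real.pi / 3)) S u v)) ∨
      (v ∈ S ∧ (ConeNearest (layerAxis 6 i) S v u ∨
        ConeNearest (layerAxis 6 i - 2 * (Real.pi / 3)) S v u ∨
        ConeNearest (layerAxis 6 i + 2 * (Real.pi / 3)) S v u))) := by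
  simp only [layer_adj_iff (by norm_num : 5 ≤ 6), SweepAdj, nearA_iff, nearB_iff, nearC_iff]

end Six

theorem fullTheta_six_adj (S : Finset Plane) (u v : Plane) : (fullTheta 6 S).Adj u v ↔ u ≠ v ∧
    ∃ n : ℤ, (u ∈ S ∧ ConeNearest (Real.pi / 2 + n * (Real.pi / 3)) S u v) ∨
      (v ∈ S ∧ ConeNearest (Real.pi / 2 + n * (Real.pi / 3)) S v u) := by
  simp only [fullTheta, isThetaNearest_iff]
  refine and_congr_right fun _ => ⟨fun ⟨j, hj⟩ => ⟨(j : ℕ), by simpa using hj⟩, fun ⟨n, hn⟩ => ?_⟩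
  obtain ⟨j, m, hjm⟩ := exists_fin_eq_add_mul (k := 6) (by norm_num) n
  have hu : unit (Real.pi / 2 + n * (Real.pi / 3)) =
      unit (Real.pi / 2 + (j : ℕ) * (Real.pi / 3)) := by
    rw [← unit_add_int_mul_two_pi (Real.pi / 2 + (j : ℕ) * (Real.pi / 3)) m, hjm]
    congr 1
    push_cast
    ring
  refine ⟨j, ?_⟩
  simpa only [coneNearest_congr hu] using hn

/-- All wedges of all layers are cones with axes `π/2 + n π/3`. Conversely each such axis is the
a-axis of some layer, so a-wedges alone already give the full theta-graph. -/
theorem layeredSweep_six_eq_fullTheta (S : Finset Plane) : layeredSweep 6 S = fullTheta 6 S := by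
  ext u v
  rw [layeredSweep, SimpleGraph.iSup_adj, fullTheta_six_adj]
  simp only [layer_six_adj]
  constructor
  · rintro ⟨i, hne, h⟩
    have ha : layerAxis 6 i = Real.pi / 2 + ((-(i : ℕ) : ℤ) : ℝ) * (Real.pi / 3) := by
      rw [layerAxis_six]
      push_cast
      ring
    have hb : layerAxis 6 i - 2 * (Real.pi / 3) =
        Real.pi / 2 + ((-(i : ℕ) - 2 : ℤ) : ℝ) * (Real.pi / 3) := by
      rw [layerAxis_six]
      push_cast
      ring
    have hc : layerAxis 6 i + 2 * (Real.pi / 3) =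
        Real.pi / 2 + ((-(i : ℕ) + 2 : ℤ) : ℝ) * (Real.pi / 3) := by
      rw [layerAxis_six]
      push_cast
      ring
    rw [hb, hc, ha] at h
    refine ⟨hne, ?_⟩
    rcases h with ⟨hu, h | h | h⟩ | ⟨hu, h | h | h⟩
    exacts [⟨_, Or.inl ⟨hu, h⟩⟩, ⟨_, Or.inl ⟨hu, h⟩⟩, ⟨_, Or.inl ⟨hu, h⟩⟩, ⟨_, Or.inr ⟨hu, h⟩⟩,
      ⟨_, Or.inr ⟨hu, h⟩⟩, ⟨_, Or.inr ⟨hu, h⟩⟩]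
  · rintro ⟨hne, n, hn⟩
    obtain ⟨i, m, him⟩ := exists_fin_eq_add_mul (k := 6) (by norm_num) (-n)
    have hu : unit (Real.pi / 2 + n * (Real.pi / 3)) = unit (layerAxis 6 i) := by
      rw [← unit_add_int_mul_two_pi _ m, layerAxis_six]
      push_cast at him
      rw [show (n : ℝ) = -((i : ℕ) + 6 * m) by linarith]
      congr 1
      ring
    simp only [coneNearest_congr hu] at hn
    exact ⟨i, hne, hn.imp (fun h => ⟨h.1, Or.inl h.2⟩) fun h => ⟨h.1, Or.inl h.2⟩⟩

/-- A cone of angle `π / 3` is a wedge of a given layer or the reflection of such a wedge. -/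
theorem ConeNearest.near_or_negFirst (i : Fin 6) {S : Finset Plane} {n : ℤ} {q p : Plane}
    (h : ConeNearest (Real.pi / 2 + n * (Real.pi / 3)) S q p) :
    (NearA (layerB 6 i) (layerC 6 i) S q p ∨ NearB (layerB 6 i) (layerC 6 i) S q p ∨
      NearC (layerB 6 i) (layerC 6 i) S q p) ∨ NegFirst (layerB 6 i) (layerC 6 i) S q p := by
  have hcr := cross_corners (by norm_num : 5 ≤ 6) i
  -- `d` counts sixths of a turn from the axis of the layer to the cone: `0, 2, 4` are the a-, c-
  -- and b-wedges, and `1, 3, 5` the reflected b-, a- and c-wedges.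
  obtain ⟨d, m, hd⟩ := exists_fin_eq_add_mul (k := 6) (by norm_num) (n + (i : ℕ))
  push_cast at hd
  have hu : ∀ (ψ : ℝ) (l : ℤ), ψ = layerAxis 6 i + (d : ℕ) * (Real.pi / 3) + l * (2 * Real.pi) →
      ConeNearest ψ S q p := by
    intro ψ l hψ
    refine (coneNearest_congr ?_ S q p).1 h
    rw [hψ, unit_add_int_mul_two_pi, layerAxis_six, show (n : ℝ) = (d : ℕ) + 6 * m - (i : ℕ) by
      linarith, ← unit_add_int_mul_two_pi (_ - _ + _) m]
    congr 1
    ring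
  have hpS := h.1.1
  have hpq := h.1.2.1
  have negA : ConeNearest (layerAxis 6 i + Real.pi) S q p →
      NegFirst (layerB 6 i) (layerC 6 i) S q p := fun h' => by
    have := h'.reflect (sideA_B i) (sideA_C i)
    simp only [mem_wedge_A hcr, sweepTime_A hcr, mul_le_mul_iff_left₀ (neg_pos.2 hcr),
      sub_le_sub_iff_left] at this
    exact ⟨hpS, hpq, Or.inl this⟩
  have negB : ConeNearest (layerAxis 6 i - 2 * (Real.pi / 3) + Real.pi) S q p →
      NegFirst (layerB 6 i) (layerC 6 i) S q p := fun h' => by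
    have := h'.reflect (sideB_C i) (sideB_A i)
    simp only [mem_wedge_B hcr, sweepTime_B hcr, mul_le_mul_iff_left₀ (neg_pos.2 hcr),
      sub_le_sub_iff_right] at this
    exact ⟨hpS, hpq, Or.inr (Or.inl this)⟩
  have negC : ConeNearest (layerAxis 6 i + 2 * (Real.pi / 3) + Real.pi) S q p →
      NegFirst (layerB 6 i) (layerC 6 i) S q p := fun h' => by
    have := h'.reflect (sideC_A i) (sideC_B i)
    simp only [mem_wedge_C hcr, sweepTime_C hcr, mul_le_mul_iff_left₀ (neg_pos.2 hcr),
      sub_le_sub_iff_right] at this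
    exact ⟨hpS, hpq, Or.inr (Or.inr this)⟩
  rw [nearA_iff, nearB_iff, nearC_iff]
  fin_cases d
  · exact Or.inl (Or.inl (hu _ 0 (by push_cast; ring)))
  · exact Or.inr (negB (hu _ 0 (by push_cast; ring)))
  · exact Or.inl (Or.inr (Or.inr (hu _ 0 (by push_cast; ring))))
  · exact Or.inr (negA (hu _ 0 (by push_cast; ring)))
  · exact Or.inl (Or.inr (Or.inl (hu _ (-1) (by push_cast; ring))))
  · exact Or.inr (negC (hu _ 0 (by push_cast; ring)))

theorem layeredSweep_six_cases (i : Fin 6) {S : Finset Plane} {u v : Plane}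
    (h : (layeredSweep 6 S).Adj u v) :
    SweepAdj (layerB 6 i) (layerC 6 i) S u v ∨ NegFirst (layerB 6 i) (layerC 6 i) S u v ∨
      NegFirst (layerB 6 i) (layerC 6 i) S v u := by
  rw [layeredSweep_six_eq_fullTheta, fullTheta_six_adj] at h
  obtain ⟨hne, n, ⟨hu, h⟩ | ⟨hv, h⟩⟩ := h
  · exact (h.near_or_negFirst i).imp (fun h' => ⟨hne, Or.inl ⟨hu, h'⟩⟩) Or.inl
  · exact (h.near_or_negFirst i).imp (fun h' => ⟨hne, Or.inr ⟨hv, h'⟩⟩) Or.inr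

theorem NoTies.tieFree {k : ℕ} (hk : 5 ≤ k) {S : Finset Plane} (h : NoTies k S) (i : Fin k) :
    TieFree (layerB k i) (layerC k i) S := by
  have hc := cross_corners hk i
  intro q hq p p'
  have := h i q hq p p'
  simp only [isFirstHit_A hc, isFirstHit_B hc, isFirstHit_C hc] at this
  exact this

theorem exists_router_one :
    ∃ R : Router 6, R.Works 1 (fun S => NoTies 6 S)
      (Real.pi / 2 + Real.pi / ((6 : ℕ) : ℝ))
      (1 / Real.cos (Real.pi / 4 + Real.pi / ((6 : ℕ) : ℝ) / 2)) := by
  have hk : 5 ≤ 6 := by norm_num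
  refine exists_router hk 1 _ fun i t u w w' S S' hS hS' hne hu hu' hview hw hw' => ?_
  have hN : ∀ v, (layeredSweep 6 S).Adj u v ↔ (layeredSweep 6 S').Adj u v := fun v => by
    rw [← localView_adj_iff one_pos, hview, localView_adj_iff one_pos]
  exact Step.unique_of_view_one (layer_inj hk i) (hS.tieFree hk i)
    (fun a b h => layer_le_layeredSweep 6 i S ((layer_adj_iff hk i S a b).2 h))
    (fun a b => layeredSweep_mem_right hk) (fun a b => layeredSweep_six_cases i)
    (hS'.tieFree hk i)
    (fun a b h => layer_le_layeredSweep 6 i S' ((layer_adj_iff hk i S' a b).2 h))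
    (fun a b => layeredSweep_mem_right hk) (fun a b => layeredSweep_six_cases i) hu hu' hne hN
    ((stepA_iff hk i S t u w).1 hw) ((stepA_iff hk i S' t u w').1 hw')

theorem width_six : Real.pi / 2 + Real.pi / ((6 : ℕ) : ℝ) = 2 * Real.pi / 3 := by
  push_cast
  ring

theorem ratio_six : 1 / Real.cos (Real.pi / 4 + Real.pi / ((6 : ℕ) : ℝ) / 2) = 2 := by
  rw [show Real.pi / 4 + Real.pi / ((6 : ℕ) : ℝ) / 2 = Real.pi / 3 by push_cast; ring,
    Real.cos_pi_div_three]
  norm_num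

end SweepRouting

open SweepRouting
theorem mainTheorem3 :
    (∀ k : ℕ, 5 ≤ k →
      ∃ R : Router k, R.Works 2 (fun _ => True)
        (Real.pi / 2 + Real.pi / k) (1 / Real.cos (Real.pi / 4 + Real.pi / k / 2))) ∧
    (∀ S : Finset Plane, layeredSweep 6 S = fullTheta 6 S) ∧
    (∃ R : Router 6, R.Works 2 (fun _ => True) (2 * Real.pi / 3) 2) ∧
    (∃ R : Router 6, R.Works 1 (fun S => NoTies 6 S) (2 * Real.pi / 3) 2) := by
  refine ⟨fun k hk => exists_router_two hk, layeredSweep_six_eq_fullTheta, ?_, ?_⟩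
  · have h := exists_router_two (k := 6) (by norm_num)
    rwa [width_six, ratio_six] at h
  · have h := exists_router_one
    rwa [width_six, ratio_six] at h
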